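/- Let $n\ge 0$ be an integer and let $V_n=\{(i,j)\in\mathbb Z^2 : |i|+|j|\le n,\ j\le 0,\ i+j\equiv n \pmod 2\}$. Call two points of $V_n$ neighbours if they differ by $\pm(2,0)$, $\pm(1,1)$ or $\pm(1,-1)$. A (simplified) grove of size $n$ is an acyclic graph $G$ with vertex set $V_n$, all of whose edges join neighbours, such that every connected component of $G$ contains exactly one of the following sets, and each of these sets is contained in some component of $G$: - $\{(-n,0)\}$, $\{(n,0)\}$, $\{(0,-n)\}$; - $\{(-i,0),(\frac{-n-i}{2},\frac{-n+i}{2})\}$ and $\{(i,0),(\frac{n+i}{2},\frac{-n+i}{2})\}$ for integers $0<i<n$ with $i\equiv n\pmod 2$; - $\{(-n+i,-i),(n-i,-i)\}$ for integers $\frac n2<i<n$; - $\{(0,0),(-\frac n2,-\frac n2),(\frac n2,-\frac n2)\}$ if $n$ is even. (Sets in this list that coincide, which happens only for $n=0$, are counted once.) A downward triangle is a triple $(a,b),(a-1,b+1),(a+1,b+1)$ of points of $V_n$. An alternating sign triangle of size $n$ is a labelling of the downward triangles by integers that arises from some grove $G$ of size $n$ by giving each downward triangle the number $1-e$, where $e$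 is the number of edges of $G$ among its three sides. Theorem. For any two alternating sign triangles $A_1,A_2$ of the same size $n$, $A_1$ can be obtained from $A_2$ by a finite (possibly empty) sequence of moves, all intermediate labellings being alternating sign triangles of size $n$. A move adds or subtracts one of the three patterns $$\begin{matrix}-1&&1\\&0&\end{matrix}\qquad\begin{matrix}1&&0\\&-1&\end{matrix}\qquad\begin{matrix}0&&-1\\&1&\end{matrix}$$ to the labels of three downward triangles with bottom vertices $(a-1,b)$ (top left entry), $(a+1,b)$ (top right entry) and $(a,b-1)$ (bottom entry), and leaves all other labels unchanged. -/

import Mathlib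

namespace AlternatingSignTriangle

/-- The vertex set of size `n`: the integer points `(i, j)` with `|i| + |j| ≤ n`, `j ≤ 0` and
`i + j ≡ n (mod 2)`. It is a triangular lattice filling the triangle with corners `(-n, 0)`,
`(n, 0)` and `(0, -n)`. -/
def vertexSet (n : ℕ) : Set (ℤ × ℤ) :=
  {p | |p.1| + |p.2| ≤ (n : ℤ) ∧ p.2 ≤ 0 ∧ p.1 + p.2 ≡ (n : ℤ) [ZMOD 2]}

/-- Two lattice points are neighbours if they are the endpoints of a side of a triangle of size one,
i.e. if they differ by `±(2, 0)`, `±(1, 1)` or `±(1, -1)`. -/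
def Neighbours (p q : ℤ × ℤ) : Prop :=
  (q - p = (2, 0) ∨ q - p = (1, 1) ∨ q - p = (1, -1)) ∨
    (p - q = (2, 0) ∨ p - q = (1, 1) ∨ p - q = (1, -1))

/-- The prescribed sets of boundary vertices of size `n`. All the integer divisions are exact. -/
inductive IsBoundaryBlock (n : ℕ) : Set (ℤ × ℤ) → Prop
  | cornerWest : IsBoundaryBlock n {(-(n : ℤ), 0)}
  | cornerEast : IsBoundaryBlock n {((n : ℤ), 0)}
  | cornerSouth : IsBoundaryBlock n {(0, -(n : ℤ))}
  | westPair (i : ℤ) (h0 : 0 < i) (hn : i < n) (hi : i ≡ (n : ℤ) [ZMOD 2]) :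
      IsBoundaryBlock n {(-i, 0), ((-(n : ℤ) - i) / 2, (-(n : ℤ) + i) / 2)}
  | eastPair (i : ℤ) (h0 : 0 < i) (hn : i < n) (hi : i ≡ (n : ℤ) [ZMOD 2]) :
      IsBoundaryBlock n {(i, 0), (((n : ℤ) + i) / 2, (-(n : ℤ) + i) / 2)}
  | southPair (i : ℤ) (h2 : (n : ℤ) < 2 * i) (hn : i < n) :
      IsBoundaryBlock n {(-(n : ℤ) + i, -i), ((n : ℤ) - i, -i)}
  | middleTriplet (hn : Even n) :
      IsBoundaryBlock n {(0, 0), (-(n : ℤ) / 2, -(n : ℤ) / 2), ((n : ℤ) / 2, -(n : ℤ) / 2)}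

/-- A (simplified) grove of size `n`: an acyclic graph on the vertices of size `n`, with edges
between neighbouring lattice points only, each of whose components contains exactly one of the
prescribed sets of boundary vertices, each such set being contained in some component. -/
structure IsGrove {n : ℕ} (G : SimpleGraph (vertexSet n)) : Prop where
  neighbours : ∀ p q : vertexSet n, G.Adj p q → Neighbours p q
  acyclic : G.IsAcyclic
  component_contains : ∀ c : G.ConnectedComponent,
    ∃! S : Set (ℤ × ℤ), IsBoundaryBlock n S ∧ S ⊆ Subtype.val '' c.supp
  block_contained : ∀ S : Set (ℤ × ℤ), IsBoundaryBlock n S →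
    ∃ c : G.ConnectedComponent, S ⊆ Subtype.val '' c.supp

/-- A downward triangle (of size one) whose vertices `(a, b)`, `(a - 1, b + 1)`, `(a + 1, b + 1)`
all lie in the vertex set of size `n`. -/
@[ext]
structure DownTriangle (n : ℕ) where
  a : ℤ
  b : ℤ
  bottom_mem : (a, b) ∈ vertexSet n
  left_mem : (a - 1, b + 1) ∈ vertexSet n
  right_mem : (a + 1, b + 1) ∈ vertexSet n

namespace DownTriangle

variable {n : ℕ}

/-- The bottom vertex of a downward triangle. -/
def bottom (t : DownTriangle n) : vertexSet n := ⟨(t.a, t.b), t.bottom_mem⟩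

/-- The top left vertex of a downward triangle. -/
def left (t : DownTriangle n) : vertexSet n := ⟨(t.a - 1, t.b + 1), t.left_mem⟩

/-- The top right vertex of a downward triangle. -/
def right (t : DownTriangle n) : vertexSet n := ⟨(t.a + 1, t.b + 1), t.right_mem⟩

end DownTriangle

open Classical in
/-- The number of edges of the graph `G` among the three sides of the downward triangle `t`. -/
noncomputable def edgeCount {n : ℕ} (G : SimpleGraph (vertexSet n)) (t : DownTriangle n) : ℤ :=
  (if G.Adj t.left t.right then 1 else 0) + (if G.Adj t.left t.bottom then 1 else 0) +
    (if G.Adj t.right t.bottom then 1 else 0)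

/-- An alternating sign triangle of size `n`: a labelling of the downward triangles that arises from
some grove of size `n` by giving each downward triangle with `e` edges the number `1 - e`. -/
def IsAlternatingSignTriangle {n : ℕ} (A : DownTriangle n → ℤ) : Prop :=
  ∃ G : SimpleGraph (vertexSet n), IsGrove G ∧ ∀ t, A t = 1 - edgeCount G t

/-- The type of alternating sign triangles of size `n`. -/
def AST (n : ℕ) : Type := {A : DownTriangle n → ℤ // IsAlternatingSignTriangle A}

/-- The entries (top left, top right, bottom) of the three sub-triangles that may be added. -/
inductive IsPattern : ℤ → ℤ → ℤ → Prop
  | first : IsPattern (-1) 1 0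
  | second : IsPattern 1 0 (-1)
  | third : IsPattern 0 (-1) 1

/-- The downward triangles `u`, `v`, `w` form a sub-triangle with two entries on top, `u` on the
left and `v` on the right, and the entry `w` below, between them. -/
def FormSubTriangle {n : ℕ} (u v w : DownTriangle n) : Prop :=
  v.a = u.a + 2 ∧ v.b = u.b ∧ w.a = u.a + 1 ∧ w.b = u.b - 1

/-- `B` arises from `A` by adding one of the three patterns at some position. -/
def IsAddition {n : ℕ} (A B : DownTriangle n → ℤ) : Prop :=
  ∃ u v w : DownTriangle n, FormSubTriangle u v w ∧
    ∃ x y z : ℤ, IsPattern x y z ∧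
      B u = A u + x ∧ B v = A v + y ∧ B w = A w + z ∧
      ∀ t, t ≠ u → t ≠ v → t ≠ w → B t = A t

/-- A move between alternating sign triangles: adding or subtracting one of the three patterns, the
result being an alternating sign triangle again. -/
def Move {n : ℕ} (A B : AST n) : Prop :=
  IsAddition A.1 B.1 ∨ IsAddition B.1 A.1

end AlternatingSignTriangle

/-! Every lattice edge is a side of exactly one downward triangle, so a grove is a set of such
sides. Label the boundary vertices by the block they belong to. Groves are then the edge sets whose
components realise this labelling with the fewest edges: in a smallest such set every edge is a
bridge, and conversely a count of components shows that a forest realising the labelling is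
smallest. The theorem follows from two facts.

Any two groves are linked by exchanges of single edges (`exchangeConnected_groveSides`). This goes
by induction from `n` to `n + 2`. Replace each downward triangle of size `n` by a star. The star
centres become the inner vertices of size `n + 2`, and the old vertices become the centres of its
upward triangles. Adding the spokes to the boundary, which are forced, gives the network of stars in
all upward triangles of size `n + 2`. Replacing these stars by triangles gives the sides of upward
triangles; the remaining lattice edges lie on the boundary, have ends with different labels and
never occur in a grove. Each star-triangle replacement is a local correspondence between solutions,
which preserves connectedness under exchanges (`ExchangeConnected.transfer`).

An exchange of single edges is a sequence of moves (`moves_of_exchange`). Let the groves be `K + e`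
and `K + f`. Some end of `e` is joined in `K` to some end of `f` (`exists_joined_ends`), and for
every edge `g` on the path between these ends `K + e + f - g` is again a grove
(`IsLeastCard.exchange_between`). Running through the path, each omitted edge shares a vertex with
the next one, so their downward triangles coincide or lie in a common sub-triangle. Changing the
omitted edge carries a unit from one triangle to the other: either nothing changes or it is a move.
-/

namespace AlternatingSignTriangle

open Finset Relation

/-! ### Edge sets realising a boundary labelling, and exchanges of edges -/

section

variable {V W E E' T ι : Type*}

/-- Two vertices are joined by an edge set `F` if some sequence of edges in `F` leads from one to the other. -/
def Joined (ends : E → V × V) (F : Finset E) : V → V → Prop :=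
  EqvGen fun x y => ∃ e ∈ F, ends e = (x, y)

/-- The edge set `F` represents a labelling of the boundary vertices if its components are the fibres of a
colouring that extends the labelling and uses no colours but the labels. -/
def Represents (ends : E → V × V) (bd : V → Prop) (lab : V → ι) (F : Finset E) : Prop :=
  ∃ c : V → ι, (∀ x, bd x → c x = lab x) ∧ (∀ x, ∃ y, bd y ∧ lab y = c x) ∧
    ∀ x y, Joined ends F x y ↔ c x = c y

/-- `F` has the least number of elements among the finite sets with property `P`. -/
def IsLeastCard (P : Finset E → Prop) (F : Finset E) : Prop :=
  P F ∧ ∀ F', P F' → F.card ≤ F'.card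

/-- Two sets with property `P` that differ by the exchange of at most one element. -/
def Exchange [DecidableEq E] (P : Finset E → Prop) (F F' : Finset E) : Prop :=
  P F ∧ P F' ∧ (F \ F').card ≤ 1

/-- Any two sets with property `P` are connected by single exchanges. -/
def ExchangeConnected [DecidableEq E] (P : Finset E → Prop) : Prop :=
  ∀ F F', P F → P F' → ReflTransGen (Exchange P) F F'

namespace Joined

variable {ends : E → V × V} {F F' : Finset E} {x y z : V}

lemma refl (x : V) : Joined ends F x x := EqvGen.refl x
lemma symm (h : Joined ends F x y) : Joined ends F y x := EqvGen.symm _ _ h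
lemma trans (h : Joined ends F x y) (h' : Joined ends F y z) : Joined ends F x z := EqvGen.trans _ _ _ h h'
lemma of_mem {e : E} (h : e ∈ F) : Joined ends F (ends e).1 (ends e).2 := EqvGen.rel _ _ ⟨e, h, rfl⟩

lemma map {ends' : E' → W × W} {G : Finset E'} (f : V → W)
    (hf : ∀ e ∈ F, Joined ends' G (f (ends e).1) (f (ends e).2)) (h : Joined ends F x y) :
    Joined ends' G (f x) (f y) := by
  induction h with
  | rel x y h => obtain ⟨e, he, hxy⟩ := h; simpa [hxy] using hf e he
  | refl x => exact refl _
  | symm x y _ ih => exact ih.symm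
  | trans x y z _ _ ih ih' => exact ih.trans ih'

lemma mono (hF : F ⊆ F') (h : Joined ends F x y) : Joined ends F' x y :=
  h.map id fun _ he => of_mem (hF he)

lemma eq_of_forall {f : V → W} (hf : ∀ e ∈ F, f (ends e).1 = f (ends e).2) (h : Joined ends F x y) :
    f x = f y := by
  induction h with
  | rel x y h => obtain ⟨e, he, hxy⟩ := h; simpa [hxy] using hf e he
  | refl x => rfl
  | symm x y _ ih => exact ih.symm
  | trans x y z _ _ ih ih' => exact ih.trans ih'

/-- A vertex without edges is joined to no other vertex. -/
lemma eq_of_isolated (hx : ∀ e ∈ F, (ends e).1 ≠ x ∧ (ends e).2 ≠ x) (h : Joined ends F x y) : y = x := by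
  have := h.eq_of_forall (f := fun z => z = x) fun e he => by simp [hx e he]
  simpa using this

lemma erase_iff [DecidableEq E] {e : E} (he : Joined ends (F.erase e) (ends e).1 (ends e).2) :
    Joined ends (F.erase e) x y ↔ Joined ends F x y := by
  refine ⟨mono (erase_subset _ _), fun h => h.map id fun e' he' => ?_⟩
  by_cases h' : e' = e
  · subst h'; exact he
  · exact of_mem (mem_erase.2 ⟨h', he'⟩)

end Joined

section Represents

variable {ends : E → V × V} {bd : V → Prop} {lab : V → ι} {F F' : Finset E}

lemma Represents.congr {ends' : E' → V × V} {G : Finset E'} (h : Represents ends bd lab F)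
    (hF : ∀ x y, Joined ends F x y ↔ Joined ends' G x y) : Represents ends' bd lab G := by
  obtain ⟨c, h1, h2, h3⟩ := h
  exact ⟨c, h1, h2, fun x y => by rw [← hF, h3]⟩

lemma Represents.lab_eq (h : Represents ends bd lab F) {x y : V} (hx : bd x) (hy : bd y) :
    Joined ends F x y ↔ lab x = lab y := by
  obtain ⟨c, h1, h2, h3⟩ := h
  rw [h3, h1 x hx, h1 y hy]

lemma Represents.exists_bd (h : Represents ends bd lab F) (x : V) : ∃ y, bd y ∧ Joined ends F x y := by
  obtain ⟨c, h1, h2, h3⟩ := h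
  obtain ⟨y, hy, hy'⟩ := h2 x
  exact ⟨y, hy, by rw [h3, h1 y hy, hy']⟩

/-- Every edge of a smallest representing set is a bridge. -/
lemma IsLeastCard.not_joined_erase [DecidableEq E] (h : IsLeastCard (Represents ends bd lab) F) {e : E} (he : e ∈ F) :
    ¬ Joined ends (F.erase e) (ends e).1 (ends e).2 := by
  intro hj
  have := h.2 _ (h.1.congr fun x y => (hj.erase_iff).symm)
  have := card_erase_lt_of_mem he
  omega

end Represents

/-! ### Counting components -/

section Count

variable [DecidableEq E] {ends : E → V × V} {F : Finset E}

omit [DecidableEq E] in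
/-- The components of an edge set. -/
def joinedSetoid (ends : E → V × V) (F : Finset E) : Setoid V :=
  ⟨Joined ends F, Joined.refl, Joined.symm, Joined.trans⟩

lemma joined_insert {e : E} {x y : V} (h : Joined ends (insert e F) x y) :
    Joined ends F x y ∨ (Joined ends F x (ends e).1 ∧ Joined ends F (ends e).2 y) ∨
      (Joined ends F x (ends e).2 ∧ Joined ends F (ends e).1 y) := by
  induction h with
  | rel x y h =>
    obtain ⟨e', he', hxy⟩ := h
    rcases mem_insert.1 he' with rfl | he'
    · right; left; simp [hxy, Joined.refl]
    · left; simpa [hxy] using Joined.of_mem (ends := ends) he'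
  | refl x => exact Or.inl (Joined.refl _)
  | symm x y _ ih =>
    rcases ih with h | ⟨h, h'⟩ | ⟨h, h'⟩
    · exact Or.inl h.symm
    · exact Or.inr (Or.inr ⟨h'.symm, h.symm⟩)
    · exact Or.inr (Or.inl ⟨h'.symm, h.symm⟩)
  | trans x y z _ _ ih ih' =>
    rcases ih with h | ⟨h, h'⟩ | ⟨h, h'⟩ <;> rcases ih' with k | ⟨k, k'⟩ | ⟨k, k'⟩
    · exact Or.inl (h.trans k)
    · exact Or.inr (Or.inl ⟨h.trans k, k'⟩)
    · exact Or.inr (Or.inr ⟨h.trans k, k'⟩)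
    · exact Or.inr (Or.inl ⟨h, h'.trans k⟩)
    · exact Or.inr (Or.inl ⟨h, k'⟩)
    · exact Or.inl (h.trans k')
    · exact Or.inr (Or.inr ⟨h, h'.trans k⟩)
    · exact Or.inl (h.trans k')
    · exact Or.inr (Or.inr ⟨h, k'⟩)

open Classical in
/-- Collapses the component of the second end of `e`, and maps the others to components of `insert e F`. -/
noncomputable def collapse (ends : E → V × V) (F : Finset E) (e : E) :
    Quotient (joinedSetoid ends F) → Option (Quotient (joinedSetoid ends (insert e F))) :=
  Quotient.lift (fun x => if Joined ends F x (ends e).2 then none else some (Quotient.mk _ x)) <| by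
    intro x y (h : Joined ends F x y)
    have : Joined ends F x (ends e).2 ↔ Joined ends F y (ends e).2 := ⟨h.symm.trans, h.trans⟩
    simp only [this]
    split_ifs
    · rfl
    · exact congrArg some (Quotient.sound (h.mono (subset_insert _ _)))

lemma collapse_injective (e : E) : Function.Injective (collapse ends F e) := by
  intro a b
  induction a using Quotient.inductionOn with | _ x => ?_
  induction b using Quotient.inductionOn with | _ y => ?_
  intro h
  simp only [collapse, Quotient.lift_mk] at h
  apply Quotient.sound
  change Joined ends F x y
  split_ifs at h with h1 h2 h2
  · exact h1.trans h2.symm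
  · have h3 : Joined ends (insert e F) x y := Quotient.exact (Option.some_injective _ h)
    rcases joined_insert h3 with h | ⟨_, h⟩ | ⟨h, _⟩
    · exact h
    · exact absurd h.symm h2
    · exact absurd h h1

lemma collapse_surjective {e : E} (he : ¬ Joined ends F (ends e).1 (ends e).2) :
    Function.Surjective (collapse ends F e) := by
  rintro (_ | a)
  · exact ⟨Quotient.mk _ (ends e).2, by simp [collapse, Joined.refl]⟩
  · induction a using Quotient.inductionOn with | _ x => ?_
    by_cases hx : Joined ends F x (ends e).2
    · refine ⟨Quotient.mk _ (ends e).1, ?_⟩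
      simp only [collapse, Quotient.lift_mk, he, if_false]
      refine congrArg some (Quotient.sound ?_)
      exact (Joined.of_mem (mem_insert_self e F)).trans (hx.symm.mono (subset_insert _ _))
    · exact ⟨Quotient.mk _ x, by simp [collapse, hx]⟩

/-- By injectivity of `collapse`, adding an edge lowers the number of components by at most one. -/
lemma card_le_card_add_components [Finite V] (F : Finset E) :
    Nat.card V ≤ F.card + Nat.card (Quotient (joinedSetoid ends F)) := by
  induction F using Finset.induction_on with
  | empty =>
    rw [card_empty, zero_add]
    refine Nat.card_le_card_of_injective (Quotient.mk _) fun x y h => ?_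
    exact ((Quotient.exact h : Joined ends ∅ x y).eq_of_isolated (by simp)).symm
  | insert e F he ih =>
    have := Nat.card_le_card_of_injective _ (collapse_injective (ends := ends) (F := F) e)
    rw [Finite.card_option] at this
    rw [card_insert_of_notMem he]
    omega

/-- For a bridge `collapse` is bijective, so the number of components drops by exactly one. -/
lemma card_add_components_of_bridges [Finite V] (F : Finset E)
    (h : ∀ e ∈ F, ¬ Joined ends (F.erase e) (ends e).1 (ends e).2) :
    F.card + Nat.card (Quotient (joinedSetoid ends F)) = Nat.card V := by
  induction F using Finset.induction_on with
  | empty =>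
    rw [card_empty, zero_add]
    refine (Nat.card_eq_of_bijective (Quotient.mk _) ⟨fun x y h => ?_, Quotient.mk_surjective⟩).symm
    exact ((Quotient.exact h : Joined ends ∅ x y).eq_of_isolated (by simp)).symm
  | insert e F he ih =>
    have he' := h e (mem_insert_self _ _)
    rw [erase_insert he] at he'
    have := Nat.card_eq_of_bijective _ ⟨collapse_injective (ends := ends) (F := F) e, collapse_surjective he'⟩
    rw [Finite.card_option] at this
    rw [card_insert_of_notMem he, ← ih, this]
    · omega
    · intro e' he'' hj
      refine h e' (mem_insert_of_mem he'') (hj.mono ?_)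
      exact erase_subset_erase _ (subset_insert _ _)

omit [DecidableEq E] in
lemma Represents.card_components {bd : V → Prop} {lab : V → ι} (h : Represents ends bd lab F) :
    Nat.card (Quotient (joinedSetoid ends F)) = Nat.card (lab '' {x | bd x}) := by
  obtain ⟨c, h1, h2, h3⟩ := h
  refine Nat.card_eq_of_bijective (Quotient.lift (fun x => ⟨c x, ?_⟩) ?_) ⟨?_, ?_⟩
  · obtain ⟨y, hy, hy'⟩ := h2 x
    exact ⟨y, hy, hy'⟩
  · intro x y h
    exact Subtype.ext ((h3 x y).1 h)
  · intro a b
    induction a using Quotient.inductionOn with | _ x => ?_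
    induction b using Quotient.inductionOn with | _ y => ?_
    intro h
    exact Quotient.sound ((h3 x y).2 (congrArg Subtype.val h))
  · rintro ⟨_, y, hy, rfl⟩
    exact ⟨Quotient.mk _ y, Subtype.ext (h1 y hy)⟩

/-- A representing set all of whose edges are bridges is a smallest one. -/
lemma isLeastCard_of_bridges [Finite V] {bd : V → Prop} {lab : V → ι} (h : Represents ends bd lab F)
    (hb : ∀ e ∈ F, ¬ Joined ends (F.erase e) (ends e).1 (ends e).2) :
    IsLeastCard (Represents ends bd lab) F := by
  refine ⟨h, fun F' h' => ?_⟩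
  have h1 := card_add_components_of_bridges F hb
  have h2 := card_le_card_add_components (ends := ends) F'
  rw [h.card_components] at h1
  rw [h'.card_components] at h2
  omega

end Count

/-- Exchange connectedness is preserved by renaming the elements and adding some fixed ones. -/
lemma ExchangeConnected.reindex [DecidableEq E] [DecidableEq E'] {P : Finset E → Prop} {P' : Finset E' → Prop} (φ : E ↪ E') (Q : Finset E')
    (hQ : ∀ e, φ e ∉ Q) (h1 : ∀ F, P F → P' (F.map φ ∪ Q))
    (h2 : ∀ F', P' F' → ∃ F, P F ∧ F' = F.map φ ∪ Q) (h : ExchangeConnected (IsLeastCard P)) :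
    ExchangeConnected (IsLeastCard P') := by
  have hcard : ∀ F : Finset E, (F.map φ ∪ Q).card = F.card + Q.card := fun F => by
    rw [card_union_of_disjoint, card_map]
    rw [disjoint_left]
    intro e he
    obtain ⟨e, _, rfl⟩ := mem_map.1 he
    exact hQ e
  have h3 : ∀ F, IsLeastCard P F → IsLeastCard P' (F.map φ ∪ Q) := fun F hF => by
    refine ⟨h1 F hF.1, fun F' hF' => ?_⟩
    obtain ⟨F', hP, rfl⟩ := h2 F' hF'
    have := hF.2 _ hP
    rw [hcard, hcard]; omega
  have h4 : ∀ F', IsLeastCard P' F' → ∃ F, IsLeastCard P F ∧ F' = F.map φ ∪ Q := fun F' hF' => by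
    obtain ⟨F, hP, rfl⟩ := h2 F' hF'.1
    refine ⟨F, ⟨hP, fun F₁ hF₁ => ?_⟩, rfl⟩
    have := hF'.2 _ (h1 _ hF₁)
    rw [hcard, hcard] at this; omega
  intro F₁ F₂ hF₁ hF₂
  obtain ⟨F₁, h₁, rfl⟩ := h4 F₁ hF₁
  obtain ⟨F₂, h₂, rfl⟩ := h4 F₂ hF₂
  refine (h F₁ F₂ h₁ h₂).lift (p := Exchange (IsLeastCard P')) (fun F => F.map φ ∪ Q) fun F F' hFF' => ?_
  refine ⟨h3 _ hFF'.1, h3 _ hFF'.2.1, le_trans ?_ hFF'.2.2⟩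
  rw [← card_map φ]
  refine card_le_card fun e he => ?_
  simp only [mem_sdiff, mem_union, mem_map] at he ⊢
  grind

/-! ### Transport of exchanges along a correspondence that acts triangle by triangle -/

section Slice

variable [DecidableEq T]

/-- The part of a set of triangle edges that lies in the triangle `t`. -/
def slice (F : Finset (T × Fin 3)) (t : T) : Finset (Fin 3) := univ.filter fun i => (t, i) ∈ F

@[simp] lemma mem_slice {F : Finset (T × Fin 3)} {t : T} {i : Fin 3} : i ∈ slice F t ↔ (t, i) ∈ F := by
  simp [slice]

lemma slice_sdiff (F F' : Finset (T × Fin 3)) (t : T) : slice (F \ F') t = slice F t \ slice F' t := by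
  ext; simp

lemma card_eq_sum_slice [Fintype T] (F : Finset (T × Fin 3)) : F.card = ∑ t, (slice F t).card := by
  rw [card_eq_sum_card_fiberwise (f := Prod.fst) (t := univ) (fun _ _ => mem_univ _)]
  refine sum_congr rfl fun t _ => ?_
  rw [← card_image_of_injective (slice F t) (f := Prod.mk t) fun i j h => (Prod.mk.inj h).2]
  congr 1
  ext ⟨s, i⟩
  simp only [mem_filter, mem_image, mem_slice, Prod.mk.injEq]
  constructor
  · rintro ⟨h, rfl⟩; exact ⟨i, h, rfl, rfl⟩
  · rintro ⟨_, h, rfl, rfl⟩; exact ⟨h, rfl⟩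

/-- The set with given slices. -/
def ofSlices [Fintype T] (s : T → Finset (Fin 3)) : Finset (T × Fin 3) := univ.filter fun e => e.2 ∈ s e.1

@[simp] lemma slice_ofSlices [Fintype T] (s : T → Finset (Fin 3)) (t : T) : slice (ofSlices s) t = s t := by
  ext; simp [ofSlices]

lemma ext_slice {F F' : Finset (T × Fin 3)} (h : ∀ t, slice F t = slice F' t) : F = F' := by
  ext ⟨t, i⟩
  rw [← mem_slice, h, mem_slice]

variable [Fintype T] {P P' : Finset (T × Fin 3) → Prop} {R : Finset (Fin 3) → Finset (Fin 3) → Prop}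

/-- The solutions that correspond to a fixed `F` are chosen independently in each triangle. Hence
`S` can be turned into `S'` one triangle at a time, and by `hR` each step exchanges at most one
element. -/
lemma exchanges_of_same_slices (hPP' : ∀ F F', P F → (∀ t, R (slice F t) (slice F' t)) → P' F')
    (hR : ∀ c s s', R c s → R c s' → (s \ s').card ≤ 1) {F S S' : Finset (T × Fin 3)} (hF : P F)
    (hS : ∀ t, R (slice F t) (slice S t)) (hS' : ∀ t, R (slice F t) (slice S' t)) :
    ReflTransGen (Exchange P') S S' := by
  let mix (U : Finset T) : Finset (T × Fin 3) := ofSlices fun t => if t ∈ U then slice S' t else slice S t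
  have hmix : ∀ U, P' (mix U) := fun U => hPP' F _ hF fun t => by
    simp only [mix, slice_ofSlices]
    split_ifs
    · exact hS' t
    · exact hS t
  have key : ∀ U, ReflTransGen (Exchange P') S (mix U) := by
    intro U
    induction U using Finset.induction_on with
    | empty =>
      have : mix ∅ = S := ext_slice fun t => by simp [mix]
      rw [this]
    | insert u U hu ih =>
      refine ih.tail ⟨hmix _, hmix _, ?_⟩
      rw [card_eq_sum_slice, sum_eq_single u]
      · simp only [slice_sdiff, mix, slice_ofSlices, hu, mem_insert_self, if_true, if_false]
        exact hR _ _ _ (hS u) (hS' u)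
      · intro t _ htu
        simp [slice_sdiff, mix, slice_ofSlices, mem_insert, htu]
      · simp
  have : mix univ = S' := ext_slice fun t => by simp [mix]
  exact this ▸ key univ

/-- Exchange connectedness is transported along a local correspondence between the slices. -/
lemma ExchangeConnected.transfer (hPP' : ∀ F F', P F → (∀ t, R (slice F t) (slice F' t)) → P' F')
    (hP'P : ∀ F', P' F' → ∃ F, P F ∧ ∀ t, R (slice F t) (slice F' t))
    (hP : ∀ F, P F → ∀ t, ∃ s, R (slice F t) s)
    (hc : ∀ F F', P F → P F' → F.card = F'.card)
    (hR : ∀ c s s', R c s → R c s' → (s \ s').card ≤ 1)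
    (hex : ∀ c c', (∃ s, R c s) → (∃ s, R c' s) → (c \ c').card ≤ 1 → (c' \ c).card ≤ 1 →
      ∃ s s', R c s ∧ R c' s' ∧ (s \ s').card ≤ (c \ c').card)
    (h : ExchangeConnected P) : ExchangeConnected P' := by
  intro S S' hS hS'
  obtain ⟨F, hF, hFS⟩ := hP'P S hS
  obtain ⟨F', hF', hFS'⟩ := hP'P S' hS'
  have key : ∀ G, ReflTransGen (Exchange P) F G → ∀ U, (∀ t, R (slice G t) (slice U t)) →
      ReflTransGen (Exchange P') S U := by
    intro G hG
    induction hG with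
    | refl => exact fun U hU => exchanges_of_same_slices hPP' hR hF hFS hU
    | @tail G K hG hGK ih =>
      intro U hU
      obtain ⟨hPG, hPK, hcard⟩ := hGK
      -- Equal cardinality makes the exchange symmetric; the local hypothesis `hex` needs both
      -- bounds.
      have hcard' : (K \ G).card ≤ 1 := by
        rwa [← card_sdiff_comm (hc _ _ hPG hPK)]
      have hloc : ∀ {A B : Finset (T × Fin 3)}, (A \ B).card ≤ 1 → ∀ t, (slice A t \ slice B t).card ≤ 1 := by
        intro A B hAB t
        rw [card_eq_sum_slice] at hAB
        refine le_trans ?_ hAB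
        rw [← slice_sdiff]
        exact single_le_sum (f := fun t => (slice (A \ B) t).card) (fun _ _ => Nat.zero_le _) (mem_univ t)
      -- The bound of `hex` is by the local difference and not by `1`, so that summing over all
      -- triangles still gives at most one exchanged element.
      choose s s' h1 h2 h3 using fun t => hex _ _ (hP G hPG t) (hP K hPK t) (hloc hcard t) (hloc hcard' t)
      have hs : P' (ofSlices s) := hPP' G _ hPG fun t => by simpa using h1 t
      have hs' : P' (ofSlices s') := hPP' K _ hPK fun t => by simpa using h2 t
      refine ((ih (ofSlices s) fun t => by simpa using h1 t).tail ⟨hs, hs', ?_⟩).trans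
        (exchanges_of_same_slices hPP' hR hPK (fun t => by simpa using h2 t) hU)
      refine le_trans ?_ hcard
      rw [card_eq_sum_slice, card_eq_sum_slice]
      refine sum_le_sum fun t _ => ?_
      simpa [slice_sdiff] using h3 t
  exact key F' (h F F' hF hF') S' hFS'

end Slice

end

/-! ### The star-triangle transformation -/

section

variable {V T ι : Type*}

/-- The ends of the side of a triangle opposite to a given vertex. -/
def triangleEnds (v : T → Fin 3 → V) (e : T × Fin 3) : V × V := (v e.1 (e.2 + 1), v e.1 (e.2 + 2))

/-- The ends of an edge from the centre of a triangle to a given vertex. -/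
def starEnds (v : T → Fin 3 → V) (e : T × Fin 3) : (V ⊕ T) × (V ⊕ T) := (.inr e.1, .inl (v e.1 e.2))

/-- The sides `c` of a triangle join the same vertices as the star with edges `s`. -/
def StarEquiv (c s : Finset (Fin 3)) : Prop :=
  s.Nonempty ∧ (∀ i ∈ c, ∀ j, j ≠ i → j ∈ s) ∧
    ∀ j ∈ s, ∀ k ∈ s, j = k ∨ (∃ i ∈ c, i ≠ j ∧ i ≠ k) ∨ (j ∈ c ∧ k ∈ c)

/-- The sides `c` of a triangle join the same vertices as the star with edges `s`, without a cycle. -/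
def StarTriangle (c s : Finset (Fin 3)) : Prop := StarEquiv c s ∧ s.card = c.card + 1

instance : DecidableRel StarEquiv := fun c s => by unfold StarEquiv; infer_instance

instance : DecidableRel StarTriangle := fun c s => by unfold StarTriangle; infer_instance

/-- `StarTriangle` pairs no side with any single spoke, one side with the two spokes to its ends,
and any two sides with all three spokes. The choices are thus threefold at both extremes, and two
choices differ by one exchange. Three sides and no spoke have no partner. -/
lemma StarTriangle.card_sdiff_right : ∀ c s s', StarTriangle c s → StarTriangle c s' → (s \ s').card ≤ 1 := by
  decide

lemma StarTriangle.card_sdiff_left : ∀ s c c', StarTriangle c s → StarTriangle c' s → (c \ c').card ≤ 1 := by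
  decide

lemma StarTriangle.exchange_right : ∀ c c', (∃ s, StarTriangle c s) → (∃ s, StarTriangle c' s) →
    (c \ c').card ≤ 1 → (c' \ c).card ≤ 1 →
      ∃ s s', StarTriangle c s ∧ StarTriangle c' s' ∧ (s \ s').card ≤ (c \ c').card := by
  decide

lemma StarTriangle.exchange_left : ∀ s s', (∃ c, StarTriangle c s) → (∃ c, StarTriangle c s') →
    (s \ s').card ≤ 1 → (s' \ s).card ≤ 1 →
      ∃ c c', StarTriangle c s ∧ StarTriangle c' s' ∧ (c \ c').card ≤ (s \ s').card := by
  decide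

/-- This covers the full triangle too, where the three spokes are fewer than `c.card + 1`; such a
cycle is excluded later by minimality. -/
lemma exists_starEquiv : ∀ c, ∃ s, StarEquiv c s ∧ s.card ≤ c.card + 1 := by
  decide

lemma exists_starTriangle : ∀ s : Finset (Fin 3), s.Nonempty → ∃ c, StarTriangle c s := by
  decide

section Network

variable [DecidableEq T] {v : T → Fin 3 → V} {bd : V → Prop} {lab : V → ι} {F S : Finset (T × Fin 3)}

/-- Boundary vertices of a network, as vertices of the network enlarged by the centres of triangles. -/
def starBd (T : Type*) (bd : V → Prop) : V ⊕ T → Prop := Sum.elim bd fun _ => False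

/-- Extends a labelling to the centres of triangles. -/
def starLab (v : T → Fin 3 → V) (lab : V → ι) : V ⊕ T → ι := Sum.elim lab fun t => lab (v t 0)

omit [DecidableEq T] in
lemma joined_side {t : T} {i j k : Fin 3} (hi : (t, i) ∈ F) (hj : j ≠ i) (hk : k ≠ i) :
    Joined (triangleEnds v) F (v t j) (v t k) := by
  have key : ∀ i j : Fin 3, j ≠ i → j = i + 1 ∨ j = i + 2 := by decide
  have h : Joined (triangleEnds v) F (v t (i + 1)) (v t (i + 2)) := Joined.of_mem hi
  rcases key i j hj with rfl | rfl <;> rcases key i k hk with rfl | rfl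
  exacts [Joined.refl _, h, h.symm, Joined.refl _]

omit [DecidableEq T] in
lemma joined_spoke {t : T} {i : Fin 3} (hi : (t, i) ∈ S) :
    Joined (starEnds v) S (.inr t) (.inl (v t i)) := Joined.of_mem hi

lemma joined_of_mem_slice (h : ∀ t, StarEquiv (slice F t) (slice S t)) {t : T} {j k : Fin 3}
    (hj : (t, j) ∈ S) (hk : (t, k) ∈ S) : Joined (triangleEnds v) F (v t j) (v t k) := by
  rcases (h t).2.2 j (mem_slice.2 hj) k (mem_slice.2 hk) with rfl | ⟨i, hi, hij, hik⟩ | ⟨hj', hk'⟩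
  · exact Joined.refl _
  · exact joined_side (mem_slice.1 hi) hij.symm hik.symm
  · by_cases hjk : j = k
    · rw [hjk]; exact Joined.refl _
    · have key : ∀ j k : Fin 3, j ≠ k → ∃ i, i ≠ j ∧ i ≠ k := by decide
      obtain ⟨i, hij, hik⟩ := key j k hjk
      exact (joined_side (mem_slice.1 hk') hjk hik).trans (joined_side (mem_slice.1 hj') hij (Ne.symm hjk))

lemma joined_inl (h : ∀ t, StarEquiv (slice F t) (slice S t)) {x y : V} (hxy : Joined (triangleEnds v) F x y) :
    Joined (starEnds v) S (.inl x) (.inl y) := by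
  refine hxy.map Sum.inl fun ⟨t, i⟩ hti => ?_
  have key : ∀ i : Fin 3, i + 1 ≠ i ∧ i + 2 ≠ i := by decide
  have h1 := (h t).2.1 i (mem_slice.2 hti) _ (key i).1
  have h2 := (h t).2.1 i (mem_slice.2 hti) _ (key i).2
  exact (joined_spoke (mem_slice.1 h1)).symm.trans (joined_spoke (mem_slice.1 h2))

/-- The centre of a star is collapsed to an end of one of its edges. -/
lemma exists_retraction (h : ∀ t, StarEquiv (slice F t) (slice S t)) :
    ∃ r : V ⊕ T → V, (∀ x, r (.inl x) = x) ∧ (∀ a, Joined (starEnds v) S a (.inl (r a))) ∧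
      ∀ a b, Joined (starEnds v) S a b → Joined (triangleEnds v) F (r a) (r b) := by
  choose j hj using fun t => (h t).1
  refine ⟨Sum.elim id fun t => v t (j t), fun x => rfl, ?_, fun a b hab => hab.map _ ?_⟩
  · rintro (x | t)
    · exact Joined.refl _
    · exact joined_spoke (mem_slice.1 (hj t))
  · rintro ⟨t, i⟩ hti
    exact joined_of_mem_slice h (mem_slice.1 (hj t)) hti

lemma Represents.star (h : ∀ t, StarEquiv (slice F t) (slice S t)) (hF : Represents (triangleEnds v) bd lab F) :
    Represents (starEnds v) (starBd T bd) (starLab v lab) S := by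
  obtain ⟨r, hr1, hr2, hr3⟩ := exists_retraction (v := v) h
  obtain ⟨c, h1, h2, h3⟩ := hF
  refine ⟨c ∘ r, ?_, fun a => ?_, fun a b => ⟨fun hab => (h3 _ _).1 (hr3 _ _ hab), fun hab => ?_⟩⟩
  · rintro (x | t) hx
    · change c (r (.inl x)) = lab x
      rw [hr1, h1 x hx]
    · exact hx.elim
  · obtain ⟨y, hy, hy'⟩ := h2 (r a)
    exact ⟨.inl y, hy, hy'⟩
  · exact (hr2 a).trans ((joined_inl h ((h3 _ _).2 hab)).trans (hr2 b).symm)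

lemma Represents.triangle (h : ∀ t, StarEquiv (slice F t) (slice S t))
    (hS : Represents (starEnds v) (starBd T bd) (starLab v lab) S) : Represents (triangleEnds v) bd lab F := by
  obtain ⟨r, hr1, hr2, hr3⟩ := exists_retraction (v := v) h
  obtain ⟨c, h1, h2, h3⟩ := hS
  refine ⟨c ∘ .inl, fun x hx => h1 (.inl x) hx, fun x => ?_, fun x y => ⟨fun hxy => ?_, fun hxy => ?_⟩⟩
  · obtain ⟨y | t, hy, hy'⟩ := h2 (.inl x)
    · exact ⟨y, hy, hy'⟩
    · exact hy.elim
  · exact (h3 _ _).1 (joined_inl h hxy)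
  · simpa [hr1] using hr3 _ _ ((h3 _ _).2 hxy)

-- A centre is not a boundary vertex but has to be joined to one, so it cannot be isolated. This
-- makes the star nonempty, as `exists_starTriangle` requires.
omit [DecidableEq T] in
lemma Represents.exists_spoke (hS : Represents (starEnds v) (starBd T bd) (starLab v lab) S) (t : T) :
    ∃ i, (t, i) ∈ S := by
  by_contra! ht
  obtain ⟨y, hy, hj⟩ := hS.exists_bd (.inr t)
  have := hj.eq_of_isolated fun e he => ⟨fun h => ht e.2 ?_, by simp [starEnds]⟩
  · subst this; exact hy
  · simp only [starEnds, Sum.inr.injEq] at h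
    rwa [← h]

variable [Fintype T]

lemma card_star (h : ∀ t, StarTriangle (slice F t) (slice S t)) : S.card = F.card + Fintype.card T := by
  rw [card_eq_sum_slice S, card_eq_sum_slice F, sum_congr rfl fun t _ => (h t).2, sum_add_distrib]
  simp

lemma Represents.exists_star (hF : Represents (triangleEnds v) bd lab F) :
    ∃ S, Represents (starEnds v) (starBd T bd) (starLab v lab) S ∧ S.card ≤ F.card + Fintype.card T ∧
      ∀ t, StarEquiv (slice F t) (slice S t) := by
  choose s hs hs' using fun t => exists_starEquiv (slice F t)
  refine ⟨ofSlices s, hF.star (by simpa using hs), ?_, by simpa using hs⟩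
  rw [card_eq_sum_slice, card_eq_sum_slice F]
  calc _ ≤ ∑ t, ((slice F t).card + 1) := sum_le_sum fun t _ => by simpa using hs' t
    _ = _ := by rw [sum_add_distrib]; simp

lemma Represents.exists_triangle (hS : Represents (starEnds v) (starBd T bd) (starLab v lab) S) :
    ∃ F, Represents (triangleEnds v) bd lab F ∧ ∀ t, StarTriangle (slice F t) (slice S t) := by
  have : ∀ t, (slice S t).Nonempty := fun t => by
    obtain ⟨i, hi⟩ := hS.exists_spoke t
    exact ⟨i, mem_slice.2 hi⟩
  choose c hc using fun t => exists_starTriangle _ (this t)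
  exact ⟨ofSlices c, hS.triangle fun t => by simpa using (hc t).1, by simpa using hc⟩

lemma IsLeastCard.star (hF : IsLeastCard (Represents (triangleEnds v) bd lab) F)
    (h : ∀ t, StarTriangle (slice F t) (slice S t)) :
    IsLeastCard (Represents (starEnds v) (starBd T bd) (starLab v lab)) S := by
  refine ⟨hF.1.star fun t => (h t).1, fun S' hS' => ?_⟩
  obtain ⟨F', hF', h'⟩ := hS'.exists_triangle
  have := hF.2 F' hF'
  rw [card_star h, card_star h']
  omega

lemma IsLeastCard.triangle (hS : IsLeastCard (Represents (starEnds v) (starBd T bd) (starLab v lab)) S)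
    (h : ∀ t, StarTriangle (slice F t) (slice S t)) :
    IsLeastCard (Represents (triangleEnds v) bd lab) F := by
  refine ⟨hS.1.triangle fun t => (h t).1, fun F' hF' => ?_⟩
  obtain ⟨S', hS', hc, _⟩ := hF'.exists_star
  have := hS.2 S' hS'
  rw [card_star h] at this
  omega

lemma IsLeastCard.exists_starTriangle (hF : IsLeastCard (Represents (triangleEnds v) bd lab) F) :
    ∃ S, ∀ t, StarTriangle (slice F t) (slice S t) := by
  choose s hs hs' using fun t => exists_starEquiv (slice F t)
  have hS := hF.1.star (S := ofSlices s) fun t => by simpa using hs t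
  obtain ⟨F', hF', h'⟩ := hS.exists_triangle
  have h1 := hF.2 F' hF'
  have h2 := card_star h'
  -- Going to stars and back gives a representing set `F'`. Minimality of `F` turns the inequality
  -- between the sums into an equality, so every local bound is attained and no slice of `F` is a
  -- full triangle.
  have h3 : ∑ t, (s t).card = ∑ t, ((slice F t).card + 1) := by
    refine le_antisymm (sum_le_sum fun t _ => hs' t) ?_
    rw [card_eq_sum_slice] at h2
    simp only [slice_ofSlices] at h2
    rw [h2, sum_add_distrib, ← card_eq_sum_slice F]
    simpa using h1
  have h4 := (sum_eq_sum_iff_of_le fun t _ => hs' t).1 h3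
  exact ⟨ofSlices s, fun t => by simpa using ⟨hs t, h4 t (mem_univ t)⟩⟩

/-- Exchange connectedness is preserved when all triangles are replaced by stars. -/
theorem ExchangeConnected.star (h : ExchangeConnected (IsLeastCard (Represents (triangleEnds v) bd lab))) :
    ExchangeConnected (IsLeastCard (Represents (starEnds v) (starBd T bd) (starLab v lab))) := by
  refine h.transfer (R := StarTriangle) (fun F S hF hS => hF.star hS) (fun S hS => ?_) (fun F hF t => ?_)
    (fun F F' hF hF' => le_antisymm (hF.2 _ hF'.1) (hF'.2 _ hF.1)) StarTriangle.card_sdiff_right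
    StarTriangle.exchange_right
  · obtain ⟨F, _, hF⟩ := hS.1.exists_triangle
    exact ⟨F, hS.triangle hF, hF⟩
  · obtain ⟨S, hS⟩ := hF.exists_starTriangle
    exact ⟨_, hS t⟩

/-- Exchange connectedness is preserved when all stars are replaced by triangles. -/
theorem ExchangeConnected.triangle
    (h : ExchangeConnected (IsLeastCard (Represents (starEnds v) (starBd T bd) (starLab v lab)))) :
    ExchangeConnected (IsLeastCard (Represents (triangleEnds v) bd lab)) := by
  refine h.transfer (R := fun s c => StarTriangle c s) (fun S F hS hF => hS.triangle hF) (fun F hF => ?_)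
    (fun S hS t => ?_) (fun F F' hF hF' => le_antisymm (hF.2 _ hF'.1) (hF'.2 _ hF.1))
    StarTriangle.card_sdiff_left StarTriangle.exchange_left
  · obtain ⟨S, hS⟩ := hF.exists_starTriangle
    exact ⟨S, hF.star hS, hS⟩
  · obtain ⟨F, _, hF⟩ := hS.1.exists_triangle
    exact ⟨_, hF t⟩

end Network

end

/-! ### Coordinates, inner and boundary vertices, boundary labels -/

section

variable {n : ℕ}

lemma mem_vertexSet_iff {p : ℤ × ℤ} : p ∈ vertexSet n ↔
    p.2 ≤ 0 ∧ p.1 - p.2 ≤ n ∧ -p.1 - p.2 ≤ n ∧ (p.1 + p.2 + n) % 2 = 0 := by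
  simp only [vertexSet, Set.mem_ofPred_eq, Int.ModEq]
  rcases abs_cases p.1 with ⟨h, _⟩ | ⟨h, _⟩ <;> rcases abs_cases p.2 with ⟨h', _⟩ | ⟨h', _⟩ <;>
    rw [h, h'] <;> omega

lemma vertexSet_finite (n : ℕ) : (vertexSet n).Finite := by
  refine ((Set.finite_Icc (-(n : ℤ)) n).prod (Set.finite_Icc (-(n : ℤ)) n)).subset fun p hp => ?_
  have := mem_vertexSet_iff.1 hp
  simp only [Set.mem_prod, Set.mem_Icc]
  omega

noncomputable instance : Fintype (vertexSet n) := (vertexSet_finite n).fintype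

noncomputable instance : Fintype (DownTriangle n) :=
  Fintype.ofInjective DownTriangle.bottom fun s t h => by
    have h' := congrArg Subtype.val h
    simp only [DownTriangle.bottom, Prod.mk.injEq] at h'
    exact DownTriangle.ext h'.1 h'.2

noncomputable instance : DecidableEq (DownTriangle n) := Classical.decEq _

/-- The position of the vertices of an upward triangle relative to the top one, and of the bottom vertex of a
downward triangle relative to the others: horizontal coordinates. -/
def dx : Fin 3 → ℤ := ![0, -1, 1]

/-- The vertical coordinates that belong to `dx`. -/
def dy : Fin 3 → ℤ := ![0, -1, -1]

lemma offset_cases (i : Fin 3) :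
    (i = 0 ∧ dx i = 0 ∧ dy i = 0 ∧ dx (i + 1) = -1 ∧ dy (i + 1) = -1 ∧ dx (i + 2) = 1 ∧ dy (i + 2) = -1) ∨
    (i = 1 ∧ dx i = -1 ∧ dy i = -1 ∧ dx (i + 1) = 1 ∧ dy (i + 1) = -1 ∧ dx (i + 2) = 0 ∧ dy (i + 2) = 0) ∨
    (i = 2 ∧ dx i = 1 ∧ dy i = -1 ∧ dx (i + 1) = 0 ∧ dy (i + 1) = 0 ∧ dx (i + 2) = -1 ∧ dy (i + 2) = -1) := by
  revert i; decide

/-- The vertices of the upward triangle of size one with top vertex `x`. -/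
def upVertex (x : vertexSet n) (i : Fin 3) : vertexSet (n + 2) :=
  ⟨(x.1.1 + dx i, x.1.2 + dy i), by
    have := mem_vertexSet_iff.1 x.2
    rw [mem_vertexSet_iff]
    rcases offset_cases i with h | h | h <;> push_cast <;> omega⟩

/-- The vertices of a downward triangle. -/
def downVertex (t : DownTriangle n) (i : Fin 3) : vertexSet n :=
  ⟨(t.a - dx i, t.b - dy i), by
    have h1 := mem_vertexSet_iff.1 t.bottom_mem
    have h2 := mem_vertexSet_iff.1 t.left_mem
    have h3 := mem_vertexSet_iff.1 t.right_mem
    dsimp only at h1 h2 h3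
    rw [mem_vertexSet_iff]
    rcases offset_cases i with h | h | h <;> dsimp only <;> omega⟩

/-- The bottom vertex of a downward triangle, as a vertex of the triangular lattice with two more rows. -/
def innerVertex (t : DownTriangle n) : vertexSet (n + 2) :=
  ⟨(t.a, t.b), by
    have h1 := mem_vertexSet_iff.1 t.bottom_mem
    rw [mem_vertexSet_iff]
    push_cast
    omega⟩

/-- The vertices on the sides of the large triangle. -/
def OnBoundary (n : ℕ) (x : vertexSet n) : Prop :=
  x.1.2 = 0 ∨ x.1.1 + x.1.2 = -n ∨ x.1.1 - x.1.2 = n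

/-- A label for the boundary vertices that tells which of them have to be connected. -/
def boundaryLabel (p : ℤ × ℤ) : ℤ × ℤ :=
  if p.2 = 0 then (p.1, 0)
  else if p.1 ≤ 0 then if p.1 ≤ p.2 then (p.1 - p.2, 0) else (0, p.2 - p.1)
  else if 0 ≤ p.1 + p.2 then (p.1 + p.2, 0) else (0, p.1 + p.2)

/-- The boundary label of a vertex. -/
def vertexLabel (n : ℕ) (x : vertexSet n) : ℤ × ℤ := boundaryLabel x.1

lemma boundaryLabel_cases (p : ℤ × ℤ) :
    (p.2 = 0 ∧ boundaryLabel p = (p.1, 0)) ∨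
    (p.2 ≠ 0 ∧ p.1 ≤ 0 ∧ p.1 ≤ p.2 ∧ boundaryLabel p = (p.1 - p.2, 0)) ∨
    (p.2 ≠ 0 ∧ p.1 ≤ 0 ∧ p.2 < p.1 ∧ boundaryLabel p = (0, p.2 - p.1)) ∨
    (p.2 ≠ 0 ∧ 0 < p.1 ∧ 0 ≤ p.1 + p.2 ∧ boundaryLabel p = (p.1 + p.2, 0)) ∨
    (p.2 ≠ 0 ∧ 0 < p.1 ∧ p.1 + p.2 < 0 ∧ boundaryLabel p = (0, p.1 + p.2)) := by
  unfold boundaryLabel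
  split_ifs <;> simp_all

lemma boundaryLabel_cases' (p : ℤ × ℤ) :
    (p.2 = 0 ∧ (boundaryLabel p).1 = p.1 ∧ (boundaryLabel p).2 = 0) ∨
    (p.2 ≠ 0 ∧ p.1 ≤ 0 ∧ p.1 ≤ p.2 ∧ (boundaryLabel p).1 = p.1 - p.2 ∧ (boundaryLabel p).2 = 0) ∨
    (p.2 ≠ 0 ∧ p.1 ≤ 0 ∧ p.2 < p.1 ∧ (boundaryLabel p).1 = 0 ∧ (boundaryLabel p).2 = p.2 - p.1) ∨
    (p.2 ≠ 0 ∧ 0 < p.1 ∧ 0 ≤ p.1 + p.2 ∧ (boundaryLabel p).1 = p.1 + p.2 ∧ (boundaryLabel p).2 = 0) ∨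
    (p.2 ≠ 0 ∧ 0 < p.1 ∧ p.1 + p.2 < 0 ∧ (boundaryLabel p).1 = 0 ∧ (boundaryLabel p).2 = p.1 + p.2) := by
  rcases boundaryLabel_cases p with h | h | h | h | h <;> simp_all

/-- The incidence behind the induction: the spoke from the centre of `t` to its vertex `i` is, seen
from that vertex, the spoke of an upward triangle to its own vertex `i`, which is the inner vertex
of `t`. -/
lemma upVertex_downVertex (t : DownTriangle n) (i : Fin 3) : upVertex (downVertex t i) i = innerVertex t := by
  simp [upVertex, downVertex, innerVertex]

lemma innerVertex_injective : Function.Injective (innerVertex (n := n)) := fun s t h => by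
  have h' := congrArg Subtype.val h
  simp only [innerVertex, Prod.mk.injEq] at h'
  exact DownTriangle.ext h'.1 h'.2

lemma not_onBoundary_innerVertex (t : DownTriangle n) : ¬ OnBoundary (n + 2) (innerVertex t) := by
  have h2 := mem_vertexSet_iff.1 t.left_mem
  have h3 := mem_vertexSet_iff.1 t.right_mem
  have h1 := mem_vertexSet_iff.1 t.bottom_mem
  dsimp only at h1 h2 h3
  simp only [OnBoundary, innerVertex]
  push_cast
  omega

lemma exists_innerVertex {x : vertexSet (n + 2)} (hx : ¬ OnBoundary (n + 2) x) : ∃ t, innerVertex t = x := by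
  obtain ⟨⟨a, b⟩, h⟩ := x
  have h' := mem_vertexSet_iff.1 h
  simp only [OnBoundary] at hx
  push_cast at hx h'
  exact ⟨⟨a, b, mem_vertexSet_iff.2 (by dsimp only at *; omega), mem_vertexSet_iff.2 (by dsimp only at *; omega),
    mem_vertexSet_iff.2 (by dsimp only at *; omega)⟩, rfl⟩

lemma vertex_eq_iff {x y : vertexSet n} : x = y ↔ x.1.1 = y.1.1 ∧ x.1.2 = y.1.2 := by
  rw [Subtype.ext_iff, Prod.ext_iff]

/-- `boundaryLabel` does not depend on `n` and is constant along the outward spokes: `p.1`, `p.1 -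
p.2` and `p.1 + p.2` are unchanged by the offsets towards the top, left and right side. -/
lemma onBoundary_of_upVertex {x : vertexSet n} {i : Fin 3} (h : OnBoundary (n + 2) (upVertex x i)) :
    OnBoundary n x ∧ vertexLabel n x = vertexLabel (n + 2) (upVertex x i) := by
  have hx := mem_vertexSet_iff.1 x.2
  simp only [OnBoundary, upVertex] at h ⊢
  push_cast at h
  refine ⟨by rcases offset_cases i with h | h | h <;> omega, ?_⟩
  simp only [vertexLabel, Prod.ext_iff]
  have h1 := boundaryLabel_cases' x.1
  have h2 := boundaryLabel_cases' (x.1.1 + dx i, x.1.2 + dy i)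
  dsimp only at h2
  rcases offset_cases i with h | h | h <;> omega

lemma upVertex_inj_of_onBoundary {x y : vertexSet n} {i j : Fin 3} (h : OnBoundary (n + 2) (upVertex x i))
    (hxy : upVertex y j = upVertex x i) : y = x ∧ j = i := by
  have hx := mem_vertexSet_iff.1 x.2
  have hy := mem_vertexSet_iff.1 y.2
  rw [vertex_eq_iff] at hxy ⊢
  simp only [OnBoundary, upVertex] at h hxy ⊢
  push_cast at h
  rcases offset_cases i with h | h | h <;> rcases offset_cases j with h' | h' | h' <;> omega

lemma exists_upVertex_onBoundary {x : vertexSet n} (h : OnBoundary n x) :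
    ∃ i, OnBoundary (n + 2) (upVertex x i) := by
  simp only [OnBoundary, upVertex] at h ⊢
  push_cast
  rcases h with h | h | h
  · exact ⟨0, by simp [dx, dy]; omega⟩
  · exact ⟨1, by simp [dx, dy]; omega⟩
  · exact ⟨2, by simp [dx, dy]; omega⟩

/-- A boundary vertex that lies in no upward triangle is a corner, and its label is unique. -/
lemma eq_of_label_eq_of_corner {x y : vertexSet (n + 2)} (hx : OnBoundary (n + 2) x) (hy : OnBoundary (n + 2) y)
    (h : ∀ z i, upVertex z i ≠ x) (hxy : vertexLabel (n + 2) x = vertexLabel (n + 2) y) : y = x := by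
  obtain ⟨⟨a, b⟩, hm⟩ := x
  have hm' := mem_vertexSet_iff.1 hm
  have hc : b = -(n + 2) ∨ a = n + 2 ∨ a = -(n + 2) := by
    by_contra hc
    simp only [OnBoundary] at hx
    push_cast at hx hm'
    rcases hx with h' | h' | h'
    · exact h ⟨(a, b), mem_vertexSet_iff.2 (by dsimp only; omega)⟩ 0 (by simp [upVertex, dx, dy])
    · exact h ⟨(a + 1, b + 1), mem_vertexSet_iff.2 (by dsimp only; omega)⟩ 1 (by simp [upVertex, dx, dy])
    · exact h ⟨(a - 1, b + 1), mem_vertexSet_iff.2 (by dsimp only; omega)⟩ 2 (by simp [upVertex, dx, dy])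
  have hy' := mem_vertexSet_iff.1 y.2
  rw [vertex_eq_iff]
  simp only [vertexLabel, OnBoundary, Prod.ext_iff] at *
  have h1 := boundaryLabel_cases' (a, b)
  have h2 := boundaryLabel_cases' y.1
  push_cast at hx hy hm' hy'
  dsimp only at *
  omega

/-- A boundary vertex other than a corner has to be connected to another one. -/
lemma exists_partner {x : vertexSet n} {i : Fin 3} (h : OnBoundary (n + 2) (upVertex x i)) :
    ∃ y, y ≠ upVertex x i ∧ OnBoundary (n + 2) y ∧
      vertexLabel (n + 2) y = vertexLabel (n + 2) (upVertex x i) := by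
  have hx := mem_vertexSet_iff.1 x.2
  generalize hz : upVertex x i = z at *
  have hz' : ¬ (z.1.2 = -(n + 2) ∨ z.1.1 = n + 2 ∨ z.1.1 = -(n + 2)) := by
    subst hz
    simp only [upVertex]
    rcases offset_cases i with h | h | h <;> omega
  clear hz hx
  obtain ⟨⟨a, b⟩, hm⟩ := z
  have hm' := mem_vertexSet_iff.1 hm
  simp only [OnBoundary] at h
  push_cast at hm' h
  dsimp only at hz' hm' h
  have key : ∀ a' b' : ℤ, (b' ≤ 0 ∧ a' - b' ≤ n + 2 ∧ -a' - b' ≤ n + 2 ∧ (a' + b' + (n + 2)) % 2 = 0) →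
      (b' = 0 ∨ a' + b' = -(n + 2) ∨ a' - b' = n + 2) → (a' ≠ a ∨ b' ≠ b) →
      boundaryLabel (a', b') = boundaryLabel (a, b) →
      ∃ y, y ≠ (⟨(a, b), hm⟩ : vertexSet (n + 2)) ∧ OnBoundary (n + 2) y ∧
        vertexLabel (n + 2) y = vertexLabel (n + 2) ⟨(a, b), hm⟩ := by
    intro a' b' h1 h2 h3 h4
    refine ⟨⟨(a', b'), mem_vertexSet_iff.2 (by push_cast; exact h1)⟩, ?_, ?_, h4⟩
    · rw [ne_eq, vertex_eq_iff]; dsimp only; omega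
    · simp only [OnBoundary]; push_cast; exact h2
  have h1 := boundaryLabel_cases' (a, b)
  have hlab : ∀ a' b', (boundaryLabel (a', b')).1 = (boundaryLabel (a, b)).1 ∧
      (boundaryLabel (a', b')).2 = (boundaryLabel (a, b)).2 → boundaryLabel (a', b') = boundaryLabel (a, b) :=
    fun a' b' h => Prod.ext h.1 h.2
  dsimp only at h1
  -- The partner of a vertex of the top side is on the left or right side, the one of a vertex in
  -- the upper part of these sides is on the top side, and the one of a vertex further down is its
  -- mirror image.
  by_cases hb : b = 0
  · by_cases ha : a ≤ 0
    · refine key ((-(n + 2) + a) / 2) ((-(n + 2) - a) / 2) (by omega) (by omega) (by omega) (hlab _ _ ?_)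
      have h2 := boundaryLabel_cases' ((-(n + 2) + a) / 2, (-(n + 2) - a) / 2)
      dsimp only at h2
      omega
    · refine key (((n + 2) + a) / 2) ((-(n + 2) + a) / 2) (by omega) (by omega) (by omega) (hlab _ _ ?_)
      have h2 := boundaryLabel_cases' (((n + 2) + a) / 2, (-(n + 2) + a) / 2)
      dsimp only at h2
      omega
  · by_cases hl : (a ≤ 0 ∧ a ≤ b)
    · refine key (a - b) 0 (by omega) (by omega) (by omega) (hlab _ _ ?_)
      have h2 := boundaryLabel_cases' (a - b, 0)
      dsimp only at h2
      omega
    by_cases hr : (0 < a ∧ 0 ≤ a + b)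
    · refine key (a + b) 0 (by omega) (by omega) (by omega) (hlab _ _ ?_)
      have h2 := boundaryLabel_cases' (a + b, 0)
      dsimp only at h2
      omega
    refine key (-a) b (by omega) (by omega) (by omega) (hlab _ _ ?_)
    have h2 := boundaryLabel_cases' (-a, b)
    dsimp only at h2
    omega

end

/-! ### The induction from `n` to `n + 2`: groves are connected by exchanges -/

section

variable {n : ℕ}

/-- The sets of triangle sides that correspond to groves: sides of downward triangles. -/
def GroveSides (n : ℕ) : Finset (DownTriangle n × Fin 3) → Prop :=
  IsLeastCard (Represents (triangleEnds downVertex) (OnBoundary n) (vertexLabel n))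

/-- The spoke in direction `i` of a downward triangle, seen from its other end. -/
def spokeEmbedding (n : ℕ) : DownTriangle n × Fin 3 ↪ vertexSet n × Fin 3 :=
  ⟨fun e => (downVertex e.1 e.2, e.2), by
    rintro ⟨s, i⟩ ⟨t, j⟩ h
    simp only [Prod.mk.injEq] at h
    obtain ⟨h, rfl⟩ := h
    rw [vertex_eq_iff] at h
    simp only [downVertex] at h
    rw [Prod.mk.injEq]
    exact ⟨DownTriangle.ext (by omega) (by omega), rfl⟩⟩

open Classical in
/-- The spokes that end in the boundary of the larger triangle. -/
noncomputable def pendants (n : ℕ) : Finset (vertexSet n × Fin 3) :=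
  univ.filter fun e => OnBoundary (n + 2) (upVertex e.1 e.2)

lemma mem_pendants {x : vertexSet n} {i : Fin 3} :
    (x, i) ∈ pendants n ↔ OnBoundary (n + 2) (upVertex x i) := by
  simp [pendants]

lemma spokeEmbedding_apply (t : DownTriangle n) (i : Fin 3) : spokeEmbedding n (t, i) = (downVertex t i, i) := rfl

lemma mem_range_spokeEmbedding {x : vertexSet n} {i : Fin 3} (h : ¬ OnBoundary (n + 2) (upVertex x i)) :
    ∃ t, downVertex t i = x ∧ innerVertex t = upVertex x i := by
  obtain ⟨t, ht⟩ := exists_innerVertex h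
  refine ⟨t, ?_, ht⟩
  rw [vertex_eq_iff] at ht ⊢
  simp only [innerVertex, upVertex, downVertex] at ht ⊢
  omega

/-- The vertices of the star network of size `n` in the one of size `n + 2`. -/
def starInclusion : vertexSet n ⊕ DownTriangle n → vertexSet (n + 2) ⊕ vertexSet n :=
  Sum.elim .inr fun t => .inl (innerVertex t)

lemma joined_starInclusion {F : Finset (DownTriangle n × Fin 3)} {G : Finset (vertexSet n × Fin 3)}
    (h : ∀ e ∈ F, spokeEmbedding n e ∈ G) {a b : vertexSet n ⊕ DownTriangle n}
    (hab : Joined (starEnds downVertex) F a b) :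
    Joined (starEnds upVertex) G (starInclusion a) (starInclusion b) := by
  refine hab.map _ fun ⟨t, i⟩ hti => ?_
  have := joined_spoke (v := upVertex) (h _ hti)
  rw [upVertex_downVertex] at this
  exact this.symm

lemma represents_enlarge {F : Finset (DownTriangle n × Fin 3)}
    (hF : Represents (starEnds downVertex) (starBd _ (OnBoundary n)) (starLab downVertex (vertexLabel n)) F) :
    Represents (starEnds upVertex) (starBd _ (OnBoundary (n + 2))) (starLab upVertex (vertexLabel (n + 2)))
      (F.map (spokeEmbedding n) ∪ pendants n) := by
  classical
  obtain ⟨c, h1, h2, h3⟩ := hF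
  -- Old vertices and centres keep their colours under the change of roles; the vertices that are
  -- not inner ones lie on the boundary and get their own labels.
  let c' : vertexSet (n + 2) ⊕ vertexSet n → ℤ × ℤ := Sum.elim
    (fun x => if h : ∃ t, innerVertex t = x then c (.inr h.choose) else vertexLabel (n + 2) x)
    fun x => c (.inl x)
  have hc1 : ∀ a, c' (starInclusion a) = c a := by
    rintro (x | t)
    · rfl
    · have h : ∃ s, innerVertex s = innerVertex t := ⟨t, rfl⟩
      have : c' (starInclusion (.inr t)) = c (.inr h.choose) := dif_pos h
      rw [this, innerVertex_injective h.choose_spec]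
  have hc2 : ∀ x, OnBoundary (n + 2) x → c' (.inl x) = vertexLabel (n + 2) x := fun x hx => by
    refine dif_neg ?_
    rintro ⟨t, rfl⟩
    exact not_onBoundary_innerVertex t hx
  have hlab : ∀ a, ∃ x i, OnBoundary (n + 2) (upVertex x i) ∧ vertexLabel (n + 2) (upVertex x i) = c a := fun a => by
    obtain ⟨x | t, hx, hx'⟩ := h2 a
    · obtain ⟨i, hi⟩ := exists_upVertex_onBoundary hx
      refine ⟨x, i, hi, ?_⟩
      rw [← (onBoundary_of_upVertex hi).2]
      exact hx'
    · exact hx.elim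
  have hsub : ∀ e ∈ F, spokeEmbedding n e ∈ F.map (spokeEmbedding n) ∪ pendants n := fun e he =>
    mem_union_left _ (mem_map_of_mem _ he)
  -- A pendant spoke ties a boundary vertex to an old vertex of the same colour, so only the three
  -- corners are new components.
  have hcov : ∀ a, (∃ b, Joined (starEnds upVertex) (F.map (spokeEmbedding n) ∪ pendants n) a (starInclusion b) ∧
      c' a = c b) ∨ ∃ x, a = .inl x ∧ OnBoundary (n + 2) x ∧ ∀ z i, upVertex z i ≠ x := by
    rintro (x | x)
    · by_cases hx : OnBoundary (n + 2) x
      · by_cases hx' : ∀ z i, upVertex z i ≠ x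
        · exact Or.inr ⟨x, rfl, hx, hx'⟩
        · push Not at hx'
          obtain ⟨z, i, rfl⟩ := hx'
          have hz := onBoundary_of_upVertex hx
          refine Or.inl ⟨.inl z, (joined_spoke (mem_union_right _ (mem_pendants.2 hx))).symm, ?_⟩
          rw [hc2 _ hx, ← hz.2, h1 (.inl z) hz.1]
          rfl
      · obtain ⟨t, rfl⟩ := exists_innerVertex hx
        exact Or.inl ⟨.inr t, Joined.refl _, hc1 (.inr t)⟩
    · exact Or.inl ⟨.inl x, Joined.refl _, rfl⟩
  have hcorner : ∀ x, OnBoundary (n + 2) x → (∀ z i, upVertex z i ≠ x) → ∀ b, c' (.inl x) ≠ c b := by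
    intro x hx hx' b hb
    obtain ⟨y, i, hy, hy'⟩ := hlab b
    refine hx' y i (eq_of_label_eq_of_corner hx hy hx' ?_)
    rw [hy', ← hb, hc2 x hx]
  refine ⟨c', ?_, ?_, fun a b => ⟨fun hab => ?_, fun hab => ?_⟩⟩
  · rintro (x | x) hx
    · exact hc2 x hx
    · exact hx.elim
  · intro a
    rcases hcov a with ⟨b, _, hb⟩ | ⟨x, rfl, hx, _⟩
    · obtain ⟨y, i, hy, hy'⟩ := hlab b
      exact ⟨.inl (upVertex y i), hy, by rw [hb, ← hy']; rfl⟩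
    · exact ⟨.inl x, hx, (hc2 x hx).symm⟩
  · refine hab.eq_of_forall ?_
    rintro e he
    rcases mem_union.1 he with he | he
    · obtain ⟨⟨t, i⟩, hti, rfl⟩ := mem_map.1 he
      have := (h3 _ _).1 (joined_spoke (v := downVertex) hti)
      simp only [starEnds, spokeEmbedding_apply, upVertex_downVertex]
      rw [← hc1, ← hc1] at this
      exact this.symm
    · obtain ⟨x, i⟩ := e
      have hx := mem_pendants.1 he
      have hx' := onBoundary_of_upVertex hx
      change c (.inl x) = c' (.inl (upVertex x i))
      rw [hc2 _ hx, ← hx'.2, h1 (.inl x) hx'.1]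
      rfl
  · rcases hcov a with ⟨a', ha, ha'⟩ | ⟨x, rfl, hx, hx'⟩ <;> rcases hcov b with ⟨b', hb, hb'⟩ | ⟨y, rfl, hy, hy'⟩
    · rw [ha', hb', ← h3] at hab
      exact ha.trans ((joined_starInclusion hsub hab).trans hb.symm)
    · exact absurd (hab.symm.trans ha') (hcorner y hy hy' a')
    · exact absurd (hab.trans hb') (hcorner x hx hx' b')
    · rw [hc2 x hx, hc2 y hy] at hab
      rw [eq_of_label_eq_of_corner hx hy hx' hab]
      exact Joined.refl _

/-- A boundary vertex of an upward triangle needs to be connected to its partner, and only one spoke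
ends in it. -/
lemma pendants_subset {G : Finset (vertexSet n × Fin 3)}
    (hG : Represents (starEnds upVertex) (starBd _ (OnBoundary (n + 2))) (starLab upVertex (vertexLabel (n + 2))) G) :
    pendants n ⊆ G := by
  rintro ⟨x, i⟩ hx
  rw [mem_pendants] at hx
  obtain ⟨y, hy, hy', hxy⟩ := exists_partner hx
  have hj : Joined (starEnds upVertex) G (.inl (upVertex x i)) (.inl y) :=
    (hG.lab_eq (x := .inl (upVertex x i)) (y := .inl y) hx hy').2 hxy.symm
  by_contra hn
  refine hy (Sum.inl_injective (hj.eq_of_isolated ?_))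
  rintro ⟨z, j⟩ hz
  refine ⟨by simp [starEnds], fun h => hn ?_⟩
  obtain ⟨rfl, rfl⟩ := upVertex_inj_of_onBoundary hx (Sum.inl_injective h)
  exact hz

/-- Contracting the pendant spokes and discarding the corners, which are isolated, recovers the
smaller network. -/
lemma represents_restrict {F : Finset (DownTriangle n × Fin 3)}
    (hG : Represents (starEnds upVertex) (starBd _ (OnBoundary (n + 2))) (starLab upVertex (vertexLabel (n + 2)))
      (F.map (spokeEmbedding n) ∪ pendants n)) :
    Represents (starEnds downVertex) (starBd _ (OnBoundary n)) (starLab downVertex (vertexLabel n)) F := by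
  have hsub : ∀ e ∈ F, spokeEmbedding n e ∈ F.map (spokeEmbedding n) ∪ pendants n := fun e he =>
    mem_union_left _ (mem_map_of_mem _ he)
  obtain ⟨c, h1, h2, h3⟩ := hG
  refine ⟨c ∘ starInclusion, ?_, fun a => ?_, fun a b => ⟨fun hab => ?_, fun hab => ?_⟩⟩
  · rintro (x | t) hx
    · obtain ⟨i, hi⟩ := exists_upVertex_onBoundary hx
      have := (h3 _ _).1 (joined_spoke (v := upVertex) (mem_union_right _ (mem_pendants.2 hi)))
      refine this.trans ((h1 (.inl (upVertex x i)) hi).trans ?_)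
      exact (onBoundary_of_upVertex hi).2.symm
    · exact hx.elim
  · obtain ⟨x | x, hx, hx'⟩ := h2 (starInclusion a)
    · by_cases hc : ∀ z i, upVertex z i ≠ x
      · exfalso
        have hj := (h3 (.inl x) (starInclusion a)).2 ((h1 (.inl x) hx).trans hx')
        have := hj.eq_of_isolated fun e _ => ⟨by simp [starEnds], fun h => hc e.1 e.2 (Sum.inl_injective h)⟩
        rcases a with y | t
        · cases this
        · rw [← Sum.inl_injective this] at hx
          exact not_onBoundary_innerVertex t hx
      · push Not at hc
        obtain ⟨z, i, rfl⟩ := hc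
        have hz := onBoundary_of_upVertex hx
        exact ⟨.inl z, hz.1, hz.2.trans hx'⟩
    · exact hx.elim
  · exact (h3 _ _).1 (joined_starInclusion hsub hab)
  · have hr : ∀ y : vertexSet (n + 2), ∃ r : vertexSet n ⊕ DownTriangle n, (∀ t, innerVertex t = y → r = .inr t) ∧
        ∀ x i, OnBoundary (n + 2) (upVertex x i) → upVertex x i = y → r = .inl x := fun y => by
      by_cases hy : OnBoundary (n + 2) y
      · by_cases hc : ∃ z i, upVertex z i = y
        · obtain ⟨z, i, rfl⟩ := hc
          refine ⟨.inl z, fun t ht => ?_, fun x j hx hxj => ?_⟩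
          · rw [← ht] at hy
            exact absurd hy (not_onBoundary_innerVertex t)
          · rw [(upVertex_inj_of_onBoundary hx hxj.symm).1]
        · push Not at hc
          -- A corner has no spokes, so its image is irrelevant; `a` is a default value.
          refine ⟨a, fun t ht => ?_, fun x i _ hxi => absurd hxi (hc x i)⟩
          rw [← ht] at hy
          exact absurd hy (not_onBoundary_innerVertex t)
      · obtain ⟨t, rfl⟩ := exists_innerVertex hy
        refine ⟨.inr t, fun s hs => by rw [innerVertex_injective hs], fun x i hx hxi => ?_⟩
        rw [hxi] at hx
        exact absurd hx hy
    choose r hr1 hr2 using hr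
    have hri : ∀ a, (Sum.elim r .inl : _ → vertexSet n ⊕ DownTriangle n) (starInclusion a) = a := by
      rintro (x | t)
      · rfl
      · exact hr1 _ t rfl
    rw [← hri a, ← hri b]
    refine Joined.map (Sum.elim r .inl) ?_ ((h3 _ _).2 hab)
    intro e he
    rcases mem_union.1 he with he | he
    · obtain ⟨⟨t, i⟩, hti, rfl⟩ := mem_map.1 he
      simp only [starEnds, spokeEmbedding_apply, upVertex_downVertex, Sum.elim_inl, Sum.elim_inr, hr1 _ t rfl]
      exact (joined_spoke hti).symm
    · obtain ⟨x, i⟩ := e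
      simp only [starEnds, Sum.elim_inl, Sum.elim_inr, hr2 _ x i (mem_pendants.1 he) rfl]
      exact Joined.refl _

lemma exchangeConnected_enlarge
    (h : ExchangeConnected (IsLeastCard
      (Represents (starEnds downVertex) (starBd _ (OnBoundary n)) (starLab downVertex (vertexLabel n))))) :
    ExchangeConnected (IsLeastCard
      (Represents (starEnds upVertex) (starBd _ (OnBoundary (n + 2))) (starLab upVertex (vertexLabel (n + 2))))) := by
  refine h.reindex (spokeEmbedding n) (pendants n) ?_ (fun F hF => represents_enlarge hF) fun G hG => ?_
  · rintro ⟨t, i⟩ ht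
    rw [spokeEmbedding_apply, mem_pendants, upVertex_downVertex] at ht
    exact not_onBoundary_innerVertex t ht
  · have hFG : G = (univ.filter fun e => spokeEmbedding n e ∈ G).map (spokeEmbedding n) ∪ pendants n := by
      ext ⟨x, i⟩
      rw [mem_union]
      refine ⟨fun hx => ?_, fun hx => ?_⟩
      · by_cases hb : OnBoundary (n + 2) (upVertex x i)
        · exact Or.inr (mem_pendants.2 hb)
        · obtain ⟨t, rfl, _⟩ := mem_range_spokeEmbedding hb
          exact Or.inl (mem_map.2 ⟨(t, i), mem_filter.2 ⟨mem_univ _, hx⟩, rfl⟩)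
      · rcases hx with hx | hx
        · obtain ⟨e, he, he'⟩ := mem_map.1 hx
          rw [← he']
          exact (mem_filter.1 he).2
        · exact pendants_subset hG hx
    exact ⟨_, represents_restrict (hFG ▸ hG), hFG⟩

/-- The downward triangle that shares a side with the upward triangle with top vertex `x`. -/
def adjacentTriangle (x : vertexSet n) (i : Fin 3) : DownTriangle (n + 2) where
  a := x.1.1 + dx (i + 1) + dx (i + 2)
  b := x.1.2 + dy (i + 1) + dy (i + 2)
  bottom_mem := by
    have := mem_vertexSet_iff.1 x.2
    rw [mem_vertexSet_iff]
    push_cast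
    rcases offset_cases i with h | h | h <;> omega
  left_mem := by
    have := mem_vertexSet_iff.1 x.2
    rw [mem_vertexSet_iff]
    push_cast
    rcases offset_cases i with h | h | h <;> omega
  right_mem := by
    have := mem_vertexSet_iff.1 x.2
    rw [mem_vertexSet_iff]
    push_cast
    rcases offset_cases i with h | h | h <;> omega

/-- The sides of upward triangles, as sides of downward triangles. -/
def sideEmbedding (n : ℕ) : vertexSet n × Fin 3 ↪ DownTriangle (n + 2) × Fin 3 :=
  ⟨fun e => (adjacentTriangle e.1 e.2, e.2), by
    rintro ⟨x, i⟩ ⟨y, j⟩ h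
    simp only [adjacentTriangle, Prod.mk.injEq, DownTriangle.mk.injEq] at h
    obtain ⟨h, rfl⟩ := h
    rw [Prod.mk.injEq, vertex_eq_iff]
    exact ⟨⟨by omega, by omega⟩, rfl⟩⟩

lemma sideEmbedding_apply (x : vertexSet n) (i : Fin 3) : sideEmbedding n (x, i) = (adjacentTriangle x i, i) := rfl

lemma ends_sideEmbedding (e : vertexSet n × Fin 3) :
    triangleEnds downVertex (sideEmbedding n e) = (triangleEnds upVertex e).swap := by
  obtain ⟨x, i⟩ := e
  simp only [triangleEnds, sideEmbedding_apply, Prod.swap, Prod.mk.injEq, vertex_eq_iff, downVertex, upVertex,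
    adjacentTriangle]
  omega

lemma joined_sideEmbedding {F : Finset (vertexSet n × Fin 3)} {x y : vertexSet (n + 2)} :
    Joined (triangleEnds upVertex) F x y ↔ Joined (triangleEnds downVertex) (F.map (sideEmbedding n)) x y := by
  refine ⟨fun h => h.map id fun e he => ?_, fun h => h.map id fun e he => ?_⟩
  · have := Joined.of_mem (ends := triangleEnds downVertex) (mem_map_of_mem (sideEmbedding n) he)
    rw [ends_sideEmbedding] at this
    exact this.symm
  · obtain ⟨e, he', rfl⟩ := mem_map.1 he
    rw [ends_sideEmbedding]
    exact (Joined.of_mem (ends := triangleEnds upVertex) he').symm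

/-- A side of a downward triangle is a side of an upward triangle or lies on the boundary and has ends with
different labels. -/
lemma side_cases (t : DownTriangle n) (i : Fin 3) :
    ((t.b - dy (i + 1) - dy (i + 2) ≤ 0 ∧
      (t.a - dx (i + 1) - dx (i + 2)) - (t.b - dy (i + 1) - dy (i + 2)) ≤ n - 2 ∧
      -(t.a - dx (i + 1) - dx (i + 2)) - (t.b - dy (i + 1) - dy (i + 2)) ≤ n - 2) ∧
      ((t.a - dx (i + 1) - dx (i + 2)) + (t.b - dy (i + 1) - dy (i + 2)) + n) % 2 = 0) ∨
    (OnBoundary n (downVertex t (i + 1)) ∧ OnBoundary n (downVertex t (i + 2)) ∧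
      vertexLabel n (downVertex t (i + 1)) ≠ vertexLabel n (downVertex t (i + 2))) := by
  have h1 := mem_vertexSet_iff.1 t.bottom_mem
  have h2 := mem_vertexSet_iff.1 t.left_mem
  have h3 := mem_vertexSet_iff.1 t.right_mem
  dsimp only at h1 h2 h3
  have h4 := boundaryLabel_cases' (t.a - dx (i + 1), t.b - dy (i + 1))
  have h5 := boundaryLabel_cases' (t.a - dx (i + 2), t.b - dy (i + 2))
  simp only [OnBoundary, vertexLabel, downVertex, ne_eq, Prod.ext_iff]
  dsimp only at h4 h5
  rcases offset_cases i with h | h | h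
  · by_cases hb : t.b + 1 = 0 <;> omega
  · by_cases hb : t.a - t.b = -n <;> omega
  · by_cases hb : t.a + t.b = n <;> omega

/-- The conclusion says in integers that the upward triangle across the side has its top vertex in
`vertexSet (n - 2)`, which also makes sense for `n < 2`. -/
lemma Represents.side_interior {F : Finset (DownTriangle n × Fin 3)}
    (hF : Represents (triangleEnds downVertex) (OnBoundary n) (vertexLabel n) F) {t : DownTriangle n} {i : Fin 3}
    (h : (t, i) ∈ F) : (t.b - dy (i + 1) - dy (i + 2) ≤ 0 ∧
      (t.a - dx (i + 1) - dx (i + 2)) - (t.b - dy (i + 1) - dy (i + 2)) ≤ n - 2 ∧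
      -(t.a - dx (i + 1) - dx (i + 2)) - (t.b - dy (i + 1) - dy (i + 2)) ≤ n - 2) ∧
      ((t.a - dx (i + 1) - dx (i + 2)) + (t.b - dy (i + 1) - dy (i + 2)) + n) % 2 = 0 := by
  rcases side_cases t i with h' | ⟨h1, h2, h3⟩
  · exact h'
  · exact absurd ((hF.lab_eq h1 h2).1 (Joined.of_mem h)) h3

lemma exchangeConnected_sides
    (h : ExchangeConnected (IsLeastCard (Represents (triangleEnds upVertex) (OnBoundary (n + 2))
      (vertexLabel (n + 2))))) : ExchangeConnected (GroveSides (n + 2)) := by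
  refine h.reindex (sideEmbedding n) ∅ (by simp) (fun F hF => ?_) fun G hG => ?_
  · rw [union_empty]
    exact hF.congr fun x y => joined_sideEmbedding
  · have hFG : G = (univ.filter fun e => sideEmbedding n e ∈ G).map (sideEmbedding n) := by
      ext ⟨t, i⟩
      refine ⟨fun ht => ?_, fun ht => ?_⟩
      · have h' := hG.side_interior ht
        push_cast at h'
        let x : vertexSet n := ⟨(t.a - dx (i + 1) - dx (i + 2), t.b - dy (i + 1) - dy (i + 2)),
          mem_vertexSet_iff.2 (by dsimp only; omega)⟩
        have hx : sideEmbedding n (x, i) = (t, i) := by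
          rw [sideEmbedding_apply, Prod.mk.injEq]
          exact ⟨DownTriangle.ext (by simp only [x, adjacentTriangle]; omega)
            (by simp only [x, adjacentTriangle]; omega), rfl⟩
        exact mem_map.2 ⟨(x, i), by simpa [hx] using ht, hx⟩
      · obtain ⟨e, he, he'⟩ := mem_map.1 ht
        rw [← he']
        exact (mem_filter.1 he).2
    refine ⟨univ.filter fun e => sideEmbedding n e ∈ G, ?_, by rw [union_empty]; exact hFG⟩
    refine hG.congr fun x y => ?_
    rw [joined_sideEmbedding, ← hFG]

/-- Adding the inequalities of `Represents.side_interior` puts the top vertex at height at least `2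
- n`, which contradicts its being at most `0`. So the only grove is empty. -/
lemma exchangeConnected_of_le_one (hn : n ≤ 1) : ExchangeConnected (GroveSides n) := by
  have key : ∀ F, GroveSides n F → F = ∅ := fun F hF => by
    refine eq_empty_of_forall_notMem fun ⟨t, i⟩ ht => ?_
    have := hF.1.side_interior ht
    omega
  intro F F' hF hF'
  rw [key F hF, key F' hF']

/-- Groves are connected by exchanges of single edges. -/
theorem exchangeConnected_groveSides (n : ℕ) : ExchangeConnected (GroveSides n) := by
  induction n using Nat.twoStepInduction with
  | zero => exact exchangeConnected_of_le_one (by omega)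
  | one => exact exchangeConnected_of_le_one (by omega)
  -- Stars in the downward triangles of size `n`, stars in the upward triangles of size `n + 2`,
  -- upward triangles, sides of downward triangles.
  | more n ih _ => exact exchangeConnected_sides (exchangeConnected_enlarge ih.star).triangle

end

/-! ### Which edges can be omitted after an exchange -/

section

variable {V E ι : Type*} [DecidableEq E] {ends : E → V × V} {bd : V → Prop} {lab : V → ι} {F K : Finset E}

lemma joined_insert_of_ends {e : E} {x y : V} (he : ends e = (x, y) ∨ ends e = (y, x)) {a b : V}
    (h : Joined ends (insert e F) a b) : Joined ends F a b ∨ (Joined ends F a x ∧ Joined ends F y b) ∨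
      (Joined ends F a y ∧ Joined ends F x b) := by
  rcases he with he | he <;> rcases joined_insert h with h | h | h <;> rw [he] at * <;> tauto

lemma IsLeastCard.not_joined {e : E} {x y : V} (he : ends e = (x, y) ∨ ends e = (y, x)) (heK : e ∉ K)
    (h : IsLeastCard (Represents ends bd lab) (insert e K)) : ¬ Joined ends K x y := by
  have := h.not_joined_erase (mem_insert_self e K)
  rw [erase_insert heK] at this
  rcases he with he | he <;> rw [he] at this
  · exact this
  · exact fun h => this h.symm

lemma components_insert [Finite V] {e : E} {x y : V} (he : ends e = (x, y) ∨ ends e = (y, x))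
    (h : ¬ Joined ends K x y) :
    Nat.card (Quotient (joinedSetoid ends K)) = Nat.card (Quotient (joinedSetoid ends (insert e K))) + 1 := by
  have h' : ¬ Joined ends K (ends e).1 (ends e).2 := by
    rcases he with he | he <;> rw [he]
    · exact h
    · exact fun h' => h h'.symm
  rw [Nat.card_eq_of_bijective _ ⟨collapse_injective (ends := ends) (F := K) e, collapse_surjective h'⟩,
    Finite.card_option]

omit [DecidableEq E] in
/-- A colouring that is constant on components represents the labelling if there are not too many components. -/
lemma represents_of_card_components [Finite V] (c : V → ι) (h1 : ∀ x, bd x → c x = lab x)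
    (h2 : ∀ x, ∃ y, bd y ∧ lab y = c x) (h3 : ∀ e ∈ F, c (ends e).1 = c (ends e).2)
    (h4 : Nat.card (Quotient (joinedSetoid ends F)) = Nat.card (lab '' {x | bd x})) :
    Represents ends bd lab F := by
  refine ⟨c, h1, h2, fun x y => ⟨fun h => h.eq_of_forall h3, fun h => ?_⟩⟩
  let φ : Quotient (joinedSetoid ends F) → lab '' {x | bd x} :=
    Quotient.lift (fun x => ⟨c x, by obtain ⟨y, hy, hy'⟩ := h2 x; exact ⟨y, hy, hy'⟩⟩)
      fun x y h => Subtype.ext (Joined.eq_of_forall (f := c) h3 h)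
  have hφ : Function.Surjective φ := by
    rintro ⟨_, y, hy, rfl⟩
    exact ⟨Quotient.mk _ y, Subtype.ext (h1 y hy)⟩
  have : Finite (lab '' {x | bd x}) := Finite.of_surjective φ hφ
  have hφ' := (Nat.bijective_iff_surjective_and_card φ).2 ⟨hφ, h4⟩
  exact Quotient.exact (hφ'.1 (a₁ := Quotient.mk _ x) (a₂ := Quotient.mk _ y) (Subtype.ext h))

variable {e f : E}

/-- Two edges that can be exchanged for each other have ends in a common component of the other edges. -/
lemma exists_joined_ends (heK : e ∉ K)
    (he : IsLeastCard (Represents ends bd lab) (insert e K))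
    (hf : IsLeastCard (Represents ends bd lab) (insert f K)) :
    ∃ x y z w, (ends e = (x, y) ∨ ends e = (y, x)) ∧ (ends f = (z, w) ∨ ends f = (w, z)) ∧ Joined ends K x z := by
  by_contra! hn
  rcases hxy : ends e with ⟨x, y⟩
  rcases hzw : ends f with ⟨z, w⟩
  have h1 := hn x y z w (Or.inl hxy) (Or.inl hzw)
  have h2 := hn x y w z (Or.inl hxy) (Or.inr hzw)
  have h3 := hn y x z w (Or.inr hxy) (Or.inl hzw)
  have h4 := hn y x w z (Or.inr hxy) (Or.inr hzw)
  -- If no end of `e` is joined to an end of `f`, then `f` is useless near `e`. The ends of `e`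
  -- reach boundary vertices within `K`; these have equal labels because of `e`, so they are joined
  -- within `K`, and `e` would close a cycle.
  have key : ∀ {a b : V}, ¬ Joined ends K a z → ¬ Joined ends K a w → Joined ends (insert f K) a b →
      Joined ends K a b := by
    intro a b ha ha' hab
    rcases joined_insert_of_ends (Or.inl hzw) hab with h | h | h
    · exact h
    · exact absurd h.1 ha
    · exact absurd h.1 ha'
  obtain ⟨b, hb, hxb⟩ := hf.1.exists_bd x
  obtain ⟨b', hb', hyb⟩ := hf.1.exists_bd y
  have hxb' := key h1 h2 hxb
  have hyb' := key h3 h4 hyb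
  have hj : Joined ends (insert e K) b b' :=
    (hxb'.mono (subset_insert _ _)).symm.trans
      ((by simpa [hxy] using Joined.of_mem (ends := ends) (mem_insert_self e K) :
        Joined ends (insert e K) x y).trans (hyb'.mono (subset_insert _ _)))
  have hj' := (hf.1.lab_eq hb hb').2 ((he.1.lab_eq hb hb').1 hj)
  have hj'' := key (fun h => h1 (hxb'.trans h)) (fun h => h2 (hxb'.trans h)) hj'
  exact he.not_joined (Or.inl hxy) heK (hxb'.trans (hj''.trans hyb'.symm))

/-- If the edges `e` and `f` can be exchanged for each other then `e` can be exchanged for any edge on the way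
from `e` to `f`. -/
lemma IsLeastCard.exchange_between [Finite V] {g : E} {x y z w : V} (hxy : ends e = (x, y) ∨ ends e = (y, x))
    (hzw : ends f = (z, w) ∨ ends f = (w, z)) (heK : e ∉ K) (hfK : f ∉ K) (hef : e ≠ f) (hgK : g ∈ K)
    (he : IsLeastCard (Represents ends bd lab) (insert e K))
    (hf : IsLeastCard (Represents ends bd lab) (insert f K)) (hxz : Joined ends K x z)
    (hg : ¬ Joined ends (K.erase g) x z) :
    IsLeastCard (Represents ends bd lab) (insert f (insert e (K.erase g))) := by
  classical
  have hxy' := he.not_joined hxy heK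
  have hzw' := hf.not_joined hzw hfK
  have hge : g ≠ e := fun h => heK (h ▸ hgK)
  have hgf : g ≠ f := fun h => hfK (h ▸ hgK)
  have hK : K.erase g ⊆ K := erase_subset _ _
  have hcard : (insert f (insert e (K.erase g))).card = (insert e K).card := by
    rw [card_insert_of_notMem, card_insert_of_notMem, card_insert_of_notMem heK, card_erase_of_mem hgK]
    · have := card_pos.2 ⟨g, hgK⟩
      omega
    · exact fun h => heK (hK h)
    · rw [mem_insert]
      exact fun h => h.elim (fun h => hef h.symm) fun h => hfK (hK h)
  -- Removing `g` from the forest `K + e` adds one component. The edge `f` takes it away again,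
  -- since a connection of its ends avoiding `f` would contradict `hzw'`, `hg` or `hxy'`.
  have hcomp : Nat.card (Quotient (joinedSetoid ends (insert f (insert e (K.erase g))))) =
      Nat.card (lab '' {x | bd x}) := by
    have h1 : ¬ Joined ends (insert e (K.erase g)) z w := by
      intro h
      rcases joined_insert_of_ends hxy h with h | h | h
      · exact hzw' (h.mono hK)
      · exact hg h.1.symm
      · exact hxy' (hxz.trans (h.1.mono hK))
    have h2 := components_insert hzw h1
    have h3 := he.not_joined_erase (mem_insert_of_mem hgK)
    rw [erase_insert_of_ne hge.symm] at h3
    have h4 := components_insert (ends := ends) (e := g) (x := (ends g).1) (Or.inl rfl) h3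
    rw [insert_comm, insert_erase hgK] at h4
    have h5 := he.1.card_components
    omega
  refine ⟨?_, fun F' hF' => hcard ▸ he.2 F' hF'⟩
  obtain ⟨c, c1, c2, c3⟩ := he.1
  obtain ⟨d, d1, d2, d3⟩ := hf.1
  have cK : ∀ {a b}, Joined ends K a b → c a = c b := fun h => (c3 _ _).1 (h.mono (subset_insert _ _))
  have dK : ∀ {a b}, Joined ends K a b → d a = d b := fun h => (d3 _ _).1 (h.mono (subset_insert _ _))
  have ce : c (ends e).1 = c (ends e).2 := (c3 _ _).1 (Joined.of_mem (mem_insert_self e K))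
  have df : d (ends f).1 = d (ends f).2 := (d3 _ _).1 (Joined.of_mem (mem_insert_self f K))
  have cxy : c x = c y := by
    rcases hxy with h | h <;> rw [h] at ce
    · exact ce
    · exact ce.symm
  have dzw : d z = d w := by
    rcases hzw with h | h <;> rw [h] at df
    · exact df
    · exact df.symm
  -- The colourings for `K + e` and `K + f` differ at most on the component of `x` and `z` in `K`.
  -- If `v` reaches the boundary only through `e` in one and only through `f` in the other, both
  -- routes enter that component, and a boundary vertex in it fixes both colours.
  have hcd : ∀ v, ¬ Joined ends K v x → c v = d v := by
    intro v hv
    obtain ⟨b, hb, hvb⟩ := he.1.exists_bd v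
    rcases joined_insert_of_ends hxy hvb with h | h | ⟨h, hb'⟩
    · rw [cK h, dK h, c1 b hb, d1 b hb]
    · exact absurd h.1 hv
    · obtain ⟨b', hb'', hvb'⟩ := hf.1.exists_bd v
      rcases joined_insert_of_ends hzw hvb' with h' | h' | ⟨h', hb'''⟩
      · rw [cK h', dK h', c1 _ hb'', d1 _ hb'']
      · exact absurd (h'.1.trans hxz.symm) hv
      · rw [cK h, ← cxy, cK hb', c1 b hb, dK h', ← dzw, dK hxz.symm, dK hb', d1 b hb]
  -- Without `g` that component splits. The part at `z`, where `f` is attached, takes the colours of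
  -- `K + f`, and the part at `x`, where `e` is attached, those of `K + e`.
  let γ : V → ι := fun v => if Joined ends (K.erase g) v z then d v else c v
  have γ1 : ∀ {v}, Joined ends (K.erase g) v z → γ v = d v := fun h => if_pos h
  have γ2 : ∀ {v}, ¬ Joined ends (K.erase g) v z → γ v = c v := fun h => if_neg h
  refine represents_of_card_components γ (fun v hv => ?_) (fun v => ?_) (fun e' he' => ?_) hcomp
  · by_cases h : Joined ends (K.erase g) v z
    · rw [γ1 h, d1 v hv]
    · rw [γ2 h, c1 v hv]
  · by_cases h : Joined ends (K.erase g) v z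
    · rw [γ1 h]; exact d2 v
    · rw [γ2 h]; exact c2 v
  · rcases mem_insert.1 he' with rfl | he'
    · have hz : γ z = d z := γ1 (Joined.refl _)
      have hw : γ w = c w := γ2 fun h => hzw' (h.mono hK).symm
      have : γ z = γ w := by rw [hz, hw, dzw, hcd w fun h => hzw' (hxz.symm.trans h.symm)]
      rcases hzw with h | h <;> rw [h]
      · exact this
      · exact this.symm
    rcases mem_insert.1 he' with rfl | he'
    · have hx : γ x = c x := γ2 hg
      have hy : γ y = c y := γ2 fun h => hxy' (hxz.trans (h.mono hK).symm)
      have : γ x = γ y := by rw [hx, hy, cxy]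
      rcases hxy with h | h <;> rw [h]
      · exact this
      · exact this.symm
    · have hj : Joined ends (K.erase g) (ends e').1 (ends e').2 := Joined.of_mem he'
      by_cases h : Joined ends (K.erase g) (ends e').1 z
      · rw [γ1 h, γ1 (hj.symm.trans h), dK (hj.mono hK)]
      · rw [γ2 h, γ2 fun h' => h (hj.trans h'), cK (hj.mono hK)]

end

/-! ### Groves as smallest representing sets of sides -/

section

variable {n : ℕ}

/-- A side of a downward triangle, as an unordered pair. -/
def side (e : DownTriangle n × Fin 3) : Sym2 (vertexSet n) :=
  s((triangleEnds downVertex e).1, (triangleEnds downVertex e).2)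

lemma side_injective : Function.Injective (side (n := n)) := by
  rintro ⟨s, i⟩ ⟨t, j⟩ h
  simp only [side, triangleEnds, Sym2.eq_iff, vertex_eq_iff, downVertex] at h
  rw [Prod.mk.injEq, DownTriangle.ext_iff]
  rcases offset_cases i with h1 | h1 | h1 <;> rcases offset_cases j with h2 | h2 | h2 <;> omega

lemma not_isDiag_side (e : DownTriangle n × Fin 3) : ¬ (side e).IsDiag := by
  obtain ⟨t, i⟩ := e
  simp only [side, triangleEnds, Sym2.mk_isDiag_iff, vertex_eq_iff, downVertex]
  rcases offset_cases i with h1 | h1 | h1 <;> omega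

/-- Neighbouring vertices are the ends of a side of a downward triangle. -/
lemma exists_side {x y : vertexSet n} (h : Neighbours x y) : ∃ e, side e = s(x, y) := by
  have key : ∀ x y : vertexSet n, y.1 - x.1 = (2, 0) ∨ y.1 - x.1 = (1, 1) ∨ y.1 - x.1 = (1, -1) →
      ∃ e, side e = s(x, y) := by
    intro x y h
    have hx := mem_vertexSet_iff.1 x.2
    have hy := mem_vertexSet_iff.1 y.2
    simp only [Prod.ext_iff, Prod.fst_sub, Prod.snd_sub] at h
    have hd : ∀ t : DownTriangle n, ∀ i, x.1.1 = t.a - dx (i + 1) → x.1.2 = t.b - dy (i + 1) →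
        y.1.1 = t.a - dx (i + 2) → y.1.2 = t.b - dy (i + 2) → ∃ e, side e = s(x, y) := by
      intro t i h1 h2 h3 h4
      refine ⟨(t, i), ?_⟩
      simp only [side, triangleEnds, Sym2.eq_iff, vertex_eq_iff, downVertex]
      omega
    have hd' : ∀ t : DownTriangle n, ∀ i, y.1.1 = t.a - dx (i + 1) → y.1.2 = t.b - dy (i + 1) →
        x.1.1 = t.a - dx (i + 2) → x.1.2 = t.b - dy (i + 2) → ∃ e, side e = s(x, y) := by
      intro t i h1 h2 h3 h4
      refine ⟨(t, i), ?_⟩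
      simp only [side, triangleEnds, Sym2.eq_iff, vertex_eq_iff, downVertex]
      omega
    -- A horizontal edge is the top of the triangle below it, a rising edge the right side of the
    -- triangle with bottom `x`, a falling edge the left side of the triangle with bottom `y`.
    rcases h with h | h | h
    · refine hd' ⟨x.1.1 + 1, x.1.2 - 1, mem_vertexSet_iff.2 (by dsimp only; omega),
        mem_vertexSet_iff.2 (by dsimp only; omega), mem_vertexSet_iff.2 (by dsimp only; omega)⟩ 0 ?_ ?_ ?_ ?_ <;>
        simp [dx, dy] <;> omega
    · refine hd ⟨x.1.1, x.1.2, mem_vertexSet_iff.2 (by dsimp only; omega),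
        mem_vertexSet_iff.2 (by dsimp only; omega), mem_vertexSet_iff.2 (by dsimp only; omega)⟩ 2 ?_ ?_ ?_ ?_ <;>
        simp [dx, dy] <;> omega
    · refine hd ⟨y.1.1, y.1.2, mem_vertexSet_iff.2 (by dsimp only; omega),
        mem_vertexSet_iff.2 (by dsimp only; omega), mem_vertexSet_iff.2 (by dsimp only; omega)⟩ 1 ?_ ?_ ?_ ?_ <;>
        simp [dx, dy] <;> omega
  rcases h with h | h
  · exact key x y h
  · obtain ⟨e, he⟩ := key y x h
    exact ⟨e, he.trans Sym2.eq_swap⟩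

lemma neighbours_of_side {e : DownTriangle n × Fin 3} {x y : vertexSet n} (h : side e = s(x, y)) :
    Neighbours x y := by
  obtain ⟨t, i⟩ := e
  simp only [side, triangleEnds, Sym2.eq_iff, vertex_eq_iff, downVertex] at h
  simp only [Neighbours, Prod.ext_iff, Prod.fst_sub, Prod.snd_sub]
  rcases offset_cases i with h1 | h1 | h1 <;> omega

/-- The graph whose edges are given sides of downward triangles. -/
def sideGraph (F : Finset (DownTriangle n × Fin 3)) : SimpleGraph (vertexSet n) :=
  SimpleGraph.fromEdgeSet (side '' F)

variable {F : Finset (DownTriangle n × Fin 3)}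

lemma sideGraph_adj {x y : vertexSet n} : (sideGraph F).Adj x y ↔ ∃ e ∈ F, side e = s(x, y) := by
  rw [sideGraph, SimpleGraph.fromEdgeSet_adj]
  refine ⟨fun h => h.1, fun h => ⟨h, ?_⟩⟩
  rintro rfl
  obtain ⟨e, _, he⟩ := h
  exact not_isDiag_side e (he ▸ rfl)

lemma sideGraph_edgeSet : (sideGraph F).edgeSet = side '' F := by
  ext e
  induction e with | _ x y => ?_
  rw [SimpleGraph.mem_edgeSet, sideGraph_adj]
  rfl

lemma joined_iff_reachable {x y : vertexSet n} :
    Joined (triangleEnds downVertex) F x y ↔ (sideGraph F).Reachable x y := by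
  constructor
  · intro h
    induction h with
    | rel x y h =>
      obtain ⟨e, he, hxy⟩ := h
      exact (sideGraph_adj.2 ⟨e, he, by simp [side, hxy]⟩).reachable
    | refl x => exact SimpleGraph.Reachable.refl _
    | symm x y _ ih => exact ih.symm
    | trans x y z _ _ ih ih' => exact ih.trans ih'
  · rintro ⟨p⟩
    induction p with
    | nil => exact Joined.refl _
    | cons h p ih =>
      refine Joined.trans ?_ ih
      obtain ⟨e, he, hxy⟩ := sideGraph_adj.1 h
      have hj := Joined.of_mem (ends := triangleEnds downVertex) he
      rcases Sym2.eq_iff.1 hxy with ⟨h1, h2⟩ | ⟨h1, h2⟩ <;> rw [h1, h2] at hj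
      · exact hj
      · exact hj.symm

lemma sideGraph_erase (e : DownTriangle n × Fin 3) :
    sideGraph (F.erase e) = (sideGraph F).deleteEdges {side e} := by
  ext x y
  rw [SimpleGraph.deleteEdges_adj, sideGraph_adj, sideGraph_adj]
  constructor
  · rintro ⟨e', he', h⟩
    refine ⟨⟨e', erase_subset _ _ he', h⟩, fun h' => ?_⟩
    rw [Set.mem_singleton_iff, ← h] at h'
    exact (mem_erase.1 he').1 (side_injective h')
  · rintro ⟨⟨e', he', h⟩, h'⟩
    refine ⟨e', mem_erase.2 ⟨?_, he'⟩, h⟩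
    rintro rfl
    exact h' h.symm

lemma isAcyclic_sideGraph_iff : (sideGraph F).IsAcyclic ↔ ∀ e ∈ F, ¬ Joined (triangleEnds downVertex) (F.erase e)
    (triangleEnds downVertex e).1 (triangleEnds downVertex e).2 := by
  rw [SimpleGraph.isAcyclic_iff_forall_isBridge, sideGraph_edgeSet]
  have : ∀ e, (sideGraph F).IsBridge (side e) ↔ ¬ Joined (triangleEnds downVertex) (F.erase e)
      (triangleEnds downVertex e).1 (triangleEnds downVertex e).2 := fun e => by
    rw [joined_iff_reachable, sideGraph_erase, side, SimpleGraph.isBridge_iff]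
  constructor
  · exact fun h e he => (this e).1 (h ⟨e, he, rfl⟩)
  · rintro h _ ⟨e, he, rfl⟩
    exact (this e).2 (h e he)

/-- The boundary vertices with the same label as `x`. -/
def blockOf (x : vertexSet n) : Set (ℤ × ℤ) :=
  Subtype.val '' {y : vertexSet n | OnBoundary n y ∧ vertexLabel n y = vertexLabel n x}

lemma mem_blockOf {x : vertexSet n} {p : ℤ × ℤ} : p ∈ blockOf x ↔
    (p.2 ≤ 0 ∧ p.1 - p.2 ≤ n ∧ -p.1 - p.2 ≤ n ∧ (p.1 + p.2 + n) % 2 = 0) ∧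
    (p.2 = 0 ∨ p.1 + p.2 = -n ∨ p.1 - p.2 = n) ∧ (boundaryLabel p).1 = (boundaryLabel x.1).1 ∧
      (boundaryLabel p).2 = (boundaryLabel x.1).2 := by
  rw [← mem_vertexSet_iff, ← Prod.ext_iff]
  constructor
  · rintro ⟨y, ⟨hy, hy'⟩, rfl⟩
    exact ⟨y.2, hy, hy'⟩
  · rintro ⟨h1, h2, h3⟩
    exact ⟨⟨p, h1⟩, ⟨h2, h3⟩, rfl⟩

/-- Together with `isBoundaryBlock_blockOf` this identifies the prescribed blocks with the fibres of
the label on the boundary. -/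
lemma IsBoundaryBlock.exists_eq {S : Set (ℤ × ℤ)} (h : IsBoundaryBlock n S) :
    ∃ x : vertexSet n, OnBoundary n x ∧ S = blockOf x := by
  have key : ∀ a b : ℤ, (b ≤ 0 ∧ a - b ≤ n ∧ -a - b ≤ n ∧ (a + b + n) % 2 = 0) →
      (b = 0 ∨ a + b = -n ∨ a - b = n) → (∀ p : ℤ × ℤ, p ∈ S ↔
        (p.2 ≤ 0 ∧ p.1 - p.2 ≤ n ∧ -p.1 - p.2 ≤ n ∧ (p.1 + p.2 + n) % 2 = 0) ∧
        (p.2 = 0 ∨ p.1 + p.2 = -n ∨ p.1 - p.2 = n) ∧ (boundaryLabel p).1 = (boundaryLabel (a, b)).1 ∧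
        (boundaryLabel p).2 = (boundaryLabel (a, b)).2) →
      ∃ x : vertexSet n, OnBoundary n x ∧ S = blockOf x := by
    intro a b h1 h2 h3
    refine ⟨⟨(a, b), mem_vertexSet_iff.2 h1⟩, h2, Set.ext fun p => ?_⟩
    rw [h3, mem_blockOf]
  cases h with
  | cornerWest =>
    refine key (-n) 0 (by omega) (by omega) fun p => ?_
    have h1 := boundaryLabel_cases' p
    have h2 := boundaryLabel_cases' (-(n : ℤ), 0)
    simp only [Set.mem_singleton_iff, Prod.ext_iff]
    dsimp only at h2
    omega
  | cornerEast =>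
    refine key n 0 (by omega) (by omega) fun p => ?_
    have h1 := boundaryLabel_cases' p
    have h2 := boundaryLabel_cases' ((n : ℤ), 0)
    simp only [Set.mem_singleton_iff, Prod.ext_iff]
    dsimp only at h2
    omega
  | cornerSouth =>
    refine key 0 (-n) (by omega) (by omega) fun p => ?_
    have h1 := boundaryLabel_cases' p
    have h2 := boundaryLabel_cases' (0, -(n : ℤ))
    simp only [Set.mem_singleton_iff, Prod.ext_iff]
    dsimp only at h2
    omega
  | westPair i h0 hn hi =>
    unfold Int.ModEq at hi
    refine key (-i) 0 (by omega) (by omega) fun p => ?_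
    have h1 := boundaryLabel_cases' p
    have h2 := boundaryLabel_cases' (-i, 0)
    simp only [Set.mem_singleton_iff, Set.mem_insert_iff, Prod.ext_iff]
    dsimp only at h2
    omega
  | eastPair i h0 hn hi =>
    unfold Int.ModEq at hi
    refine key i 0 (by omega) (by omega) fun p => ?_
    have h1 := boundaryLabel_cases' p
    have h2 := boundaryLabel_cases' (i, 0)
    simp only [Set.mem_singleton_iff, Set.mem_insert_iff, Prod.ext_iff]
    dsimp only at h2
    omega
  | southPair i h2 hn =>
    refine key (-n + i) (-i) (by omega) (by omega) fun p => ?_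
    have h1 := boundaryLabel_cases' p
    have h2 := boundaryLabel_cases' (-n + i, -i)
    simp only [Set.mem_singleton_iff, Set.mem_insert_iff, Prod.ext_iff]
    dsimp only at h2
    omega
  | middleTriplet hn =>
    obtain ⟨k, hk⟩ := hn
    have hk1 : -(n : ℤ) / 2 = -k := by omega
    have hk2 : (n : ℤ) / 2 = k := by omega
    rw [hk1, hk2] at key ⊢
    refine key 0 0 (by omega) (by omega) fun p => ?_
    have h1 := boundaryLabel_cases' p
    have h2 : boundaryLabel (0, 0) = (0, 0) := rfl
    simp only [Set.mem_singleton_iff, Set.mem_insert_iff, Prod.ext_iff, h2]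
    rcases h1 with h1 | h1 | h1 | h1 | h1 <;> omega

lemma exists_block_mem {x : vertexSet n} (hx : OnBoundary n x) : ∃ S, IsBoundaryBlock n S ∧ x.1 ∈ S := by
  have hx' := mem_vertexSet_iff.1 x.2
  obtain ⟨⟨a, b⟩, hm⟩ := x
  have key : ∀ {S : Set (ℤ × ℤ)} {c d : ℤ}, IsBoundaryBlock n S → (c, d) ∈ S → a = c → b = d →
      ∃ S, IsBoundaryBlock n S ∧ (a, b) ∈ S := by
    rintro S c d hS hp rfl rfl
    exact ⟨S, hS, hp⟩
  simp only [OnBoundary] at hx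
  dsimp only at hx hx'
  have hW := fun i h0 hn hi => IsBoundaryBlock.westPair (n := n) i h0 hn hi
  have hE := fun i h0 hn hi => IsBoundaryBlock.eastPair (n := n) i h0 hn hi
  have hS := fun i h0 hn => IsBoundaryBlock.southPair (n := n) i h0 hn
  simp only [Int.ModEq] at hW hE
  by_cases h1 : a = -n
  · exact key .cornerWest (Set.mem_singleton _) h1 (by omega)
  by_cases h2 : a = n
  · exact key .cornerEast (Set.mem_singleton _) h2 (by omega)
  by_cases h3 : b = -n
  · exact key .cornerSouth (Set.mem_singleton _) (by omega) h3
  by_cases hb : b = 0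
  · rcases lt_trichotomy a 0 with ha | ha | ha
    · exact key (hW (-a) (by omega) (by omega) (by omega)) (Set.mem_insert _ _) (by omega) hb
    · exact key (.middleTriplet ⟨(n / 2 : ℕ), by omega⟩) (Set.mem_insert _ _) ha hb
    · exact key (hE a (by omega) (by omega) (by omega)) (Set.mem_insert _ _) rfl hb
  by_cases hl : a + b = -n
  · rcases lt_trichotomy a b with ha | ha | ha
    · exact key (hW (b - a) (by omega) (by omega) (by omega)) (Set.mem_insert_of_mem _ rfl) (by omega) (by omega)
    · exact key (.middleTriplet ⟨(n / 2 : ℕ), by omega⟩) (Set.mem_insert_of_mem _ (Set.mem_insert _ _))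
        (by omega) (by omega)
    · exact key (hS (-b) (by omega) (by omega)) (Set.mem_insert _ _) (by omega) (by omega)
  · rcases lt_trichotomy (a + b) 0 with ha | ha | ha
    · exact key (hS (-b) (by omega) (by omega)) (Set.mem_insert_of_mem _ rfl) (by omega) (by omega)
    · exact key (.middleTriplet ⟨(n / 2 : ℕ), by omega⟩) (Set.mem_insert_of_mem _ (Set.mem_insert_of_mem _ rfl))
        (by omega) (by omega)
    · exact key (hE (a + b) (by omega) (by omega) (by omega)) (Set.mem_insert_of_mem _ rfl) (by omega) (by omega)

lemma blockOf_eq_iff {x y : vertexSet n} (hx : OnBoundary n x) :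
    blockOf x = blockOf y ↔ vertexLabel n x = vertexLabel n y := by
  refine ⟨fun h => ?_, fun h => by rw [blockOf, blockOf, h]⟩
  have : x.1 ∈ blockOf y := h ▸ ⟨x, ⟨hx, rfl⟩, rfl⟩
  obtain ⟨z, hz, hzx⟩ := this
  rw [← Subtype.ext hzx, hz.2]

lemma isBoundaryBlock_blockOf {x : vertexSet n} (hx : OnBoundary n x) : IsBoundaryBlock n (blockOf x) := by
  obtain ⟨S, hS, hxS⟩ := exists_block_mem hx
  obtain ⟨y, hy, rfl⟩ := hS.exists_eq
  obtain ⟨z, hz, hzx⟩ := hxS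
  rw [Subtype.ext hzx] at hz
  rwa [(blockOf_eq_iff hx).2 hz.2]

lemma blockOf_subset_iff {G : SimpleGraph (vertexSet n)} {x y : vertexSet n} :
    blockOf x ⊆ Subtype.val '' (G.connectedComponentMk y).supp ↔
      ∀ z, OnBoundary n z → vertexLabel n z = vertexLabel n x → G.Reachable z y := by
  rw [blockOf, Set.image_subset_image_iff Subtype.val_injective]
  constructor
  · intro h z hz hzx
    exact SimpleGraph.ConnectedComponent.exact (h ⟨hz, hzx⟩)
  · rintro h z ⟨hz, hzx⟩
    exact SimpleGraph.ConnectedComponent.sound (h z hz hzx)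

lemma GroveSides.isGrove (hF : GroveSides n F) : IsGrove (sideGraph F) where
  neighbours p q h := by
    obtain ⟨e, _, he⟩ := sideGraph_adj.1 h
    exact neighbours_of_side he
  acyclic := isAcyclic_sideGraph_iff.2 fun e he => hF.not_joined_erase he
  component_contains c := by
    obtain ⟨k, h1, h2, h3⟩ := hF.1
    induction c using SimpleGraph.ConnectedComponent.ind with | _ x => ?_
    obtain ⟨y, hy, hyx⟩ := h2 x
    refine ⟨blockOf y, ⟨isBoundaryBlock_blockOf hy, blockOf_subset_iff.2 fun z hz hzy => ?_⟩, ?_⟩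
    · rw [← joined_iff_reachable, h3, h1 z hz, hzy, hyx]
    · rintro S ⟨hS, hSx⟩
      obtain ⟨z, hz, rfl⟩ := hS.exists_eq
      have := blockOf_subset_iff.1 hSx z hz rfl
      rw [← joined_iff_reachable, h3, h1 z hz, ← hyx] at this
      exact (blockOf_eq_iff hz).2 this
  block_contained S hS := by
    obtain ⟨x, hx, rfl⟩ := hS.exists_eq
    refine ⟨(sideGraph F).connectedComponentMk x, blockOf_subset_iff.2 fun z hz hzx => ?_⟩
    rw [← joined_iff_reachable, hF.1.lab_eq hz hx, hzx]

lemma IsGrove.exists_groveSides {G : SimpleGraph (vertexSet n)} (hG : IsGrove G) :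
    ∃ F, GroveSides n F ∧ G = sideGraph F := by
  classical
  let F : Finset (DownTriangle n × Fin 3) := univ.filter fun e => side e ∈ G.edgeSet
  have hGF : G = sideGraph F := by
    ext x y
    rw [sideGraph_adj]
    constructor
    · intro h
      obtain ⟨e, he⟩ := exists_side (hG.neighbours x y h)
      exact ⟨e, mem_filter.2 ⟨mem_univ _, by rw [he]; exact h⟩, he⟩
    · rintro ⟨e, he, hxy⟩
      have := (mem_filter.1 he).2
      rw [hxy] at this
      exact this
  have hsame : ∀ x y, OnBoundary n x → OnBoundary n y → (G.Reachable x y ↔ vertexLabel n x = vertexLabel n y) := by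
    have hblock : ∀ x y, OnBoundary n x → OnBoundary n y → vertexLabel n y = vertexLabel n x → G.Reachable y x := by
      intro x y hx hy hyx
      obtain ⟨c, hc⟩ := hG.block_contained _ (isBoundaryBlock_blockOf hx)
      induction c using SimpleGraph.ConnectedComponent.ind with | _ z => ?_
      rw [blockOf_subset_iff] at hc
      exact (hc y hy hyx).trans (hc x hx rfl).symm
    refine fun x y hx hy => ⟨fun h => ?_, fun h => hblock y x hy hx h⟩
    rw [← blockOf_eq_iff hx]
    refine (hG.component_contains (G.connectedComponentMk x)).unique
      ⟨isBoundaryBlock_blockOf hx, blockOf_subset_iff.2 fun z hz hzx => hblock x z hx hz hzx⟩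
      ⟨isBoundaryBlock_blockOf hy, blockOf_subset_iff.2 fun z hz hzy => (hblock y z hy hz hzy).trans h.symm⟩
  have hbd : ∀ x, ∃ y, OnBoundary n y ∧ G.Reachable x y := fun x => by
    obtain ⟨S, ⟨hS, hSx⟩, _⟩ := hG.component_contains (G.connectedComponentMk x)
    obtain ⟨y, hy, rfl⟩ := hS.exists_eq
    exact ⟨y, hy, (blockOf_subset_iff.1 hSx y hy rfl).symm⟩
  choose r hr hxr using hbd
  refine ⟨F, isLeastCard_of_bridges ⟨fun x => vertexLabel n (r x), fun x hx => ?_, fun x => ⟨r x, hr x, rfl⟩,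
    fun x y => ?_⟩ (isAcyclic_sideGraph_iff.1 (hGF ▸ hG.acyclic)), hGF⟩
  · exact (hsame _ _ (hr x) hx).1 (hxr x).symm
  · rw [joined_iff_reachable, ← hGF, ← hsame _ _ (hr x) (hr y)]
    exact ⟨fun h => (hxr x).symm.trans (h.trans (hxr y)), fun h => (hxr x).trans (h.trans (hxr y).symm)⟩

lemma edgeCount_sideGraph (t : DownTriangle n) : edgeCount (sideGraph F) t = (slice F t).card := by
  have h : ∀ i, side (t, i) ∈ (sideGraph F).edgeSet ↔ (t, i) ∈ F := fun i => by
    rw [sideGraph_edgeSet]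
    exact side_injective.mem_set_image
  have hl : t.left = downVertex t 2 := by
    rw [vertex_eq_iff]; simp [DownTriangle.left, downVertex, dx, dy]
  have hr : t.right = downVertex t 1 := by
    rw [vertex_eq_iff]; simp [DownTriangle.right, downVertex, dx, dy]
  have hb : t.bottom = downVertex t 0 := by
    rw [vertex_eq_iff]; simp [DownTriangle.bottom, downVertex, dx, dy]
  have h0 : (sideGraph F).Adj t.left t.right ↔ (t, 0) ∈ F := by
    rw [← h, hl, hr, SimpleGraph.adj_comm]; rfl
  have h1 : (sideGraph F).Adj t.left t.bottom ↔ (t, 1) ∈ F := by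
    rw [← h, hl, hb]; rfl
  have h2 : (sideGraph F).Adj t.right t.bottom ↔ (t, 2) ∈ F := by
    rw [← h, hr, hb, SimpleGraph.adj_comm]; rfl
  simp only [edgeCount, h0, h1, h2, slice, card_filter, Fin.sum_univ_three]
  push_cast
  rfl

end

/-! ### From exchanges of edges to moves -/

section

variable {n : ℕ} {F F' K U : Finset (DownTriangle n × Fin 3)}

/-- The alternating sign triangle of a grove that is given by its edges. -/
noncomputable def GroveSides.toAST (hF : GroveSides n F) : AST n :=
  ⟨fun t => 1 - (slice F t).card, sideGraph F, hF.isGrove, fun t => by rw [edgeCount_sideGraph]⟩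

lemma GroveSides.toAST_apply (hF : GroveSides n F) (t : DownTriangle n) :
    hF.toAST.1 t = 1 - ((slice F t).card : ℤ) := rfl

lemma exists_toAST_eq (A : AST n) : ∃ F, ∃ hF : GroveSides n F, hF.toAST = A := by
  obtain ⟨A, G, hG, hA⟩ := A
  obtain ⟨F, hF, rfl⟩ := hG.exists_groveSides
  refine ⟨F, hF, Subtype.ext (funext fun t => ?_)⟩
  have := hA t
  rw [edgeCount_sideGraph] at this
  exact this.symm

lemma card_slice_erase {g : DownTriangle n × Fin 3} (hg : g ∈ U) (t : DownTriangle n) :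
    ((slice (U.erase g) t).card : ℤ) = (slice U t).card - if t = g.1 then 1 else 0 := by
  obtain ⟨s, i⟩ := g
  split_ifs with h
  · have h : t = s := h
    subst h
    have : slice (U.erase (t, i)) t = (slice U t).erase i := by ext j; simp
    rw [this, card_erase_of_mem (mem_slice.2 hg)]
    have := card_pos.2 ⟨i, mem_slice.2 hg⟩
    omega
  · have h : t ≠ s := h
    have : slice (U.erase (s, i)) t = slice U t := by ext j; simp [h]
    rw [this, sub_zero]

/-- Two downward triangles with a common vertex lie in a sub-triangle. -/
lemma exists_formSubTriangle {s t : DownTriangle n} {i j : Fin 3} (hst : s ≠ t)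
    (h : downVertex s i = downVertex t j) : ∃ u v w : DownTriangle n, FormSubTriangle u v w ∧
      ((s = u ∧ t = v) ∨ (s = v ∧ t = u) ∨ (s = v ∧ t = w) ∨ (s = w ∧ t = v) ∨ (s = u ∧ t = w) ∨
        (s = w ∧ t = u)) := by
  have key : ∀ {s t : DownTriangle n}, (t.a = s.a + 1 ∧ t.b = s.b - 1) ∨ (t.a = s.a - 1 ∧ t.b = s.b - 1) ∨
      (t.a = s.a + 2 ∧ t.b = s.b) → ∃ u v w : DownTriangle n, FormSubTriangle u v w ∧
      ((s = u ∧ t = v) ∨ (s = v ∧ t = w) ∨ (s = u ∧ t = w)) := by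
    intro s t h
    have h1 := mem_vertexSet_iff.1 s.bottom_mem
    have h2 := mem_vertexSet_iff.1 s.left_mem
    have h3 := mem_vertexSet_iff.1 s.right_mem
    have h4 := mem_vertexSet_iff.1 t.bottom_mem
    have h5 := mem_vertexSet_iff.1 t.left_mem
    have h6 := mem_vertexSet_iff.1 t.right_mem
    dsimp only at h1 h2 h3 h4 h5 h6
    rcases h with h | h | h
    · exact ⟨s, ⟨s.a + 2, s.b, mem_vertexSet_iff.2 (by dsimp only; omega),
        mem_vertexSet_iff.2 (by dsimp only; omega), mem_vertexSet_iff.2 (by dsimp only; omega)⟩, t,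
        ⟨rfl, rfl, h.1, h.2⟩, by simp⟩
    · exact ⟨⟨s.a - 2, s.b, mem_vertexSet_iff.2 (by dsimp only; omega),
        mem_vertexSet_iff.2 (by dsimp only; omega), mem_vertexSet_iff.2 (by dsimp only; omega)⟩, s, t,
        ⟨by dsimp only; omega, rfl, by dsimp only; omega, h.2⟩, by simp⟩
    · exact ⟨s, t, ⟨s.a + 1, s.b - 1, mem_vertexSet_iff.2 (by dsimp only; omega),
        mem_vertexSet_iff.2 (by dsimp only; omega), mem_vertexSet_iff.2 (by dsimp only; omega)⟩,
        ⟨h.1, h.2, rfl, rfl⟩, by simp⟩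
  rw [vertex_eq_iff] at h
  simp only [downVertex] at h
  have hst' : ¬ (s.a = t.a ∧ s.b = t.b) := fun h => hst (DownTriangle.ext h.1 h.2)
  have : ((t.a = s.a + 1 ∧ t.b = s.b - 1) ∨ (t.a = s.a - 1 ∧ t.b = s.b - 1) ∨ (t.a = s.a + 2 ∧ t.b = s.b)) ∨
      ((s.a = t.a + 1 ∧ s.b = t.b - 1) ∨ (s.a = t.a - 1 ∧ s.b = t.b - 1) ∨ (s.a = t.a + 2 ∧ s.b = t.b)) := by
    rcases offset_cases i with h1 | h1 | h1 <;> rcases offset_cases j with h2 | h2 | h2 <;> omega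
  rcases this with h | h <;> obtain ⟨u, v, w, hF, h⟩ := key h <;> exact ⟨u, v, w, hF, by tauto⟩

lemma FormSubTriangle.distinct {u v w : DownTriangle n} (h : FormSubTriangle u v w) : u ≠ v ∧ u ≠ w ∧ v ≠ w := by
  obtain ⟨h1, h2, h3, h4⟩ := h
  refine ⟨?_, ?_, ?_⟩ <;> rintro rfl <;> omega

/-- Moving a unit from one downward triangle to another one with a common vertex is a move. -/
lemma move_of_common_vertex {A B : AST n} {L : DownTriangle n → ℤ} {s t : DownTriangle n} {i j : Fin 3}
    (hst : s ≠ t) (h : downVertex s i = downVertex t j) (hA : ∀ r, A.1 r = L r + if r = s then 1 else 0)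
    (hB : ∀ r, B.1 r = L r + if r = t then 1 else 0) : Move A B := by
  obtain ⟨u, v, w, hF, h⟩ := exists_formSubTriangle hst h
  obtain ⟨h1, h2, h3⟩ := hF.distinct
  have key : ∀ {C D : DownTriangle n → ℤ} {p q : DownTriangle n} {x y z : ℤ}, IsPattern x y z →
      (∀ r, C r = L r + if r = p then 1 else 0) → (∀ r, D r = L r + if r = q then 1 else 0) →
      (p = u ∨ p = v ∨ p = w) → (q = u ∨ q = v ∨ q = w) →
      (x = (if u = q then 1 else 0) - if u = p then 1 else 0) →
      (y = (if v = q then 1 else 0) - if v = p then 1 else 0) →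
      (z = (if w = q then 1 else 0) - if w = p then 1 else 0) → IsAddition C D := by
    intro C D p q x y z hP hC hD hp hq hx hy hz
    refine ⟨u, v, w, hF, x, y, z, hP, ?_, ?_, ?_, fun r hu hv hw => ?_⟩
    · rw [hC, hD, hx]; ring
    · rw [hC, hD, hy]; ring
    · rw [hC, hD, hz]; ring
    · have hrp : r ≠ p := by rcases hp with rfl | rfl | rfl <;> assumption
      have hrq : r ≠ q := by rcases hq with rfl | rfl | rfl <;> assumption
      rw [hC, hD, if_neg hrp, if_neg hrq]
  -- Carrying a unit between two of the three positions can be done in six ways: adding one of the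
  -- three patterns, or subtracting one.
  rcases h with ⟨rfl, rfl⟩ | ⟨rfl, rfl⟩ | ⟨rfl, rfl⟩ | ⟨rfl, rfl⟩ | ⟨rfl, rfl⟩ | ⟨rfl, rfl⟩
  · exact Or.inl (key .first hA hB (by simp) (by simp) (by simp [h1]) (by simp [h1.symm])
      (by simp [h2.symm, h3.symm]))
  · exact Or.inr (key .first hB hA (by simp) (by simp) (by simp [h1]) (by simp [h1.symm])
      (by simp [h2.symm, h3.symm]))
  · exact Or.inl (key .third hA hB (by simp) (by simp) (by simp [h1, h2]) (by simp [h3]) (by simp [h3.symm]))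
  · exact Or.inr (key .third hB hA (by simp) (by simp) (by simp [h1, h2]) (by simp [h3]) (by simp [h3.symm]))
  · exact Or.inr (key .second hB hA (by simp) (by simp) (by simp [h2]) (by simp [h1.symm, h3])
      (by simp [h2.symm]))
  · exact Or.inl (key .second hA hB (by simp) (by simp) (by simp [h2]) (by simp [h1.symm, h3])
      (by simp [h2.symm]))

lemma exists_downVertex_of_mem_side {e : DownTriangle n × Fin 3} {x : vertexSet n} (h : x ∈ side e) :
    ∃ i, downVertex e.1 i = x := by
  rcases Sym2.mem_iff.1 h with h | h
  · exact ⟨_, h.symm⟩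
  · exact ⟨_, h.symm⟩

/-- Replacing an edge of a grove by another one with a common end. -/
lemma moves_of_common_end {g h : DownTriangle n × Fin 3} {x : vertexSet n} (hgU : g ∈ U) (hhU : h ∈ U)
    (hxg : x ∈ side g) (hxh : x ∈ side h) (hg : GroveSides n (U.erase g)) (hh : GroveSides n (U.erase h)) :
    ReflTransGen Move hg.toAST hh.toAST := by
  have hL : ∀ {g : DownTriangle n × Fin 3} (hgU : g ∈ U) (hg : GroveSides n (U.erase g)) (r : DownTriangle n),
      hg.toAST.1 r = (1 - ((slice U r).card : ℤ)) + if r = g.1 then 1 else 0 := fun hgU hg r => by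
    rw [GroveSides.toAST_apply, card_slice_erase hgU]
    ring
  by_cases hgh : g.1 = h.1
  · have : hg.toAST = hh.toAST := Subtype.ext (funext fun r => by rw [hL hgU, hL hhU, hgh])
    rw [this]
  · obtain ⟨i, hi⟩ := exists_downVertex_of_mem_side hxg
    obtain ⟨j, hj⟩ := exists_downVertex_of_mem_side hxh
    exact .single (move_of_common_vertex hgh (hi.trans hj.symm) (hL hgU hg) (hL hhU hh))

/-- The omitted edge runs along the walk, from `h` at its start to `f` at its end; consecutive
omitted edges meet in a vertex of the walk. -/
lemma moves_along_walk {f : DownTriangle n × Fin 3} (hKU : K ⊆ U) (hfU : f ∈ U) (hf : GroveSides n (U.erase f))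
    {x z : vertexSet n} (hz : z ∈ side f) (p : (sideGraph K).Walk x z)
    (hp : ∀ g ∈ K, side g ∈ p.edges → GroveSides n (U.erase g)) {h : DownTriangle n × Fin 3} (hhU : h ∈ U)
    (hx : x ∈ side h) (hh : GroveSides n (U.erase h)) : ReflTransGen Move hh.toAST hf.toAST := by
  induction p generalizing h with
  | nil => exact moves_of_common_end hhU hfU hx hz hh hf
  | @cons x y z hxy p ih =>
    obtain ⟨g, hgK, hg⟩ := sideGraph_adj.1 hxy
    have hgU := hp g hgK (by simp [hg])
    refine (moves_of_common_end hhU (hKU hgK) hx (hg ▸ Sym2.mem_mk_left x y) hh hgU).trans ?_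
    exact ih hz (fun g hg hgp => hp g hg (by simp [hgp])) (hKU hgK) (hg ▸ Sym2.mem_mk_right x y) hgU

lemma mem_side_of_ends {e : DownTriangle n × Fin 3} {x y : vertexSet n}
    (h : triangleEnds downVertex e = (x, y) ∨ triangleEnds downVertex e = (y, x)) : x ∈ side e := by
  rcases h with h | h <;> simp [side, h]

lemma sideGraph_mono (h : K ⊆ F) : sideGraph K ≤ sideGraph F := fun x y hxy => by
  obtain ⟨e, he, hxy⟩ := sideGraph_adj.1 hxy
  exact sideGraph_adj.2 ⟨e, h he, hxy⟩

/-- Removing an edge of a path in a forest separates its ends. -/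
lemma not_joined_erase_of_mem_path (hK : (sideGraph K).IsAcyclic) {x z : vertexSet n}
    (p : (sideGraph K).Path x z) {g : DownTriangle n × Fin 3} (hg : side g ∈ p.1.edges) :
    ¬ Joined (triangleEnds downVertex) (K.erase g) x z := by
  classical
  rw [joined_iff_reachable, sideGraph_erase, side, SimpleGraph.reachable_deleteEdges_iff_exists_walk]
  rintro ⟨w, hw⟩
  -- A walk avoiding `g` would contain a path avoiding `g`, but paths in a forest are unique.
  rw [(hK.subsingleton_path x z).elim p w.toPath] at hg
  exact hw (w.edges_toPath_subset_edges hg)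

/-- The exchange of two edges in a grove gives a sequence of moves. -/
lemma moves_of_exchange (hF : GroveSides n F) (hF' : GroveSides n F') (h : (F \ F').card ≤ 1) :
    ReflTransGen Move hF'.toAST hF.toAST := by
  have hc : F.card = F'.card := le_antisymm (hF.2 _ hF'.1) (hF'.2 _ hF.1)
  have hc' := card_sdiff_comm hc
  rcases Nat.le_one_iff_eq_zero_or_eq_one.1 h with h | h
  · have h1 := sdiff_eq_empty_iff_subset.1 (card_eq_zero.1 h)
    have h2 := sdiff_eq_empty_iff_subset.1 (card_eq_zero.1 (hc' ▸ h))
    obtain rfl := h1.antisymm h2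
    exact .refl
  obtain ⟨e, he⟩ := card_eq_one.1 h
  obtain ⟨f, hf⟩ := card_eq_one.1 (hc' ▸ h)
  obtain ⟨heF, heF'⟩ := mem_sdiff.1 (he ▸ mem_singleton_self e)
  obtain ⟨hfF', hfF⟩ := mem_sdiff.1 (hf ▸ mem_singleton_self f)
  let K := F ∩ F'
  have heK : e ∉ K := fun h => heF' (mem_inter.1 h).2
  have hfK : f ∉ K := fun h => hfF (mem_inter.1 h).1
  have hef : e ≠ f := fun h => hfF (h ▸ heF)
  have hFK : F = insert e K := by
    rw [insert_eq, ← he]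
    exact (sdiff_union_inter F F').symm
  have hFK' : F' = insert f K := by
    rw [insert_eq, ← hf, show K = F' ∩ F from inter_comm _ _]
    exact (sdiff_union_inter F' F).symm
  have hFe : GroveSides n (insert e K) := hFK ▸ hF
  have hFf : GroveSides n (insert f K) := hFK' ▸ hF'
  obtain ⟨x, y, z, w, hxy, hzw, hxz⟩ := exists_joined_ends heK hFe hFf
  have hacyc : (sideGraph K).IsAcyclic := hF.isGrove.acyclic.anti (sideGraph_mono inter_subset_left)
  obtain ⟨p⟩ := joined_iff_reachable.1 hxz
  classical
  -- Both groves arise from `U` by omitting an edge: `F'` by omitting `e`, and `F` by omitting `f`.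
  let U := insert f (insert e K)
  have hUe : U.erase e = F' := by
    rw [hFK', erase_insert_of_ne hef.symm, erase_insert heK]
  have hUf : U.erase f = F := by
    rw [hFK, erase_insert]
    rw [mem_insert]
    exact fun h => h.elim (fun h => hef h.symm) hfK
  have key := moves_along_walk (K := K) (U := U) (f := f)
    ((subset_insert _ _).trans (subset_insert _ _)) (mem_insert_self _ _) (hUf.symm ▸ hF) (mem_side_of_ends hzw)
    p.toPath.1 (fun g hg hgp => ?_) (h := e) (mem_insert_of_mem (mem_insert_self _ _)) (mem_side_of_ends hxy)
    (hUe.symm ▸ hF')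
  · have hA : ∀ {G G'} (hG : GroveSides n G) (hG' : GroveSides n G'), G = G' → hG.toAST = hG'.toAST := by
      rintro G _ hG hG' rfl
      rfl
    rwa [hA _ hF' hUe, hA _ hF hUf] at key
  · have hge : g ≠ e := fun h => heK (h ▸ hg)
    have hgf : g ≠ f := fun h => hfK (h ▸ hg)
    have := IsLeastCard.exchange_between hxy hzw heK hfK hef hg hFe hFf hxz
      (not_joined_erase_of_mem_path hacyc _ hgp)
    rwa [← erase_insert_of_ne hge.symm, ← erase_insert_of_ne hgf.symm] at this

lemma moves_of_exchanges (hF : GroveSides n F) (hF' : GroveSides n F')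
    (h : ReflTransGen (Exchange (GroveSides n)) F F') : ReflTransGen Move hF'.toAST hF.toAST := by
  induction h with
  | refl => exact .refl
  | tail _ h ih => exact (moves_of_exchange h.1 hF' h.2.2).trans (ih h.1)

end

end AlternatingSignTriangle

theorem theorem2 (n : ℕ) (A₁ A₂ : AlternatingSignTriangle.AST n) :
    Relation.ReflTransGen AlternatingSignTriangle.Move A₂ A₁ := by
  obtain ⟨F₁, h₁, rfl⟩ := AlternatingSignTriangle.exists_toAST_eq A₁
  obtain ⟨F₂, h₂, rfl⟩ := AlternatingSignTriangle.exists_toAST_eq A₂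
  exact AlternatingSignTriangle.moves_of_exchanges h₁ h₂
    (AlternatingSignTriangle.exchangeConnected_groveSides n F₁ F₂ h₁ h₂)
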